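/- **Trees and AOTPSs.** Let $(\Sigma,\mathrm{rank},\mathrm{ord})$ be a finite ranked alphabet in which each letter has an order $\mathrm{ord}(a)\in\{1,\dots,n\}$. For each order there are infinitely many variables; variables are used as leaves. Trees are finite, and the order of a tree is the order of its root label. An *alternating ordered tree-pushdown system* (AOTPS) of order $n\ge 1$ consists of such an alphabet, a finite set $P$ of control locations and a finite set of rules $p,l\to S,r$ with $p\in P$, $S\subseteq P$ and $(\Sigma\cup\text{variables})$-trees $l,r$ such that each variable occurs at most once in $l$, every variable of $r$ occurs in $l$, and $l$ has one of the forms $a(u_1,\dots,u_m)$ (shallow) or $a(u_1,\dots,u_k,b(v_1,\dots,v_{m'}),u_{k+1},\dots,u_m)$ (deep), where each $u_i$, $v_j$ is a variable or shares no variable with $r$, and where in the deep form each $u_i$ with $\mathrm{ord}(u_i)\le\mathrm{ord}(b)$ shares no variable with $r$. Configurations are pairs $(p,t)$ with $p\in P$ and $t$ a tree without variables; each such rule and each order-preserving substitution $\sigma$ give a transition $(p,l\sigma)\to S\times\{r\sigma\}$. **Krivine machines.** Types are $0$ and $\alpha\to\beta$, with $\mathrm{level}(0)=0$ and $\mathrm{level}(\alpha\to\beta)=\max(\mathrm{level}(\alpha)+1,\mathrm{level}(\beta))$.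 Terms are simply typed terms built from constants $a^{0^k\to 0}$ ($a$ a letter of rank $k$ of a finite ranked alphabet $\Gamma$), typed variables, abstractions, applications and fixpoints $(Y M^{\alpha\to\alpha})^\alpha$. A closure is a pair $(M,\rho)$ in which $\rho$ assigns to each free variable of $M$ (and to nothing else) a closure of the same type. An *alternating Krivine machine with states of level $l$* consists of $\Gamma$, a finite set $Q$ of states, a set $\Delta$ of transitions $q\xrightarrow{a}P_1\cdots P_k$ ($a\in\Gamma$ of rank $k$, $P_i\subseteq Q$), and a closed term $K^0$ of type $0$ all of whose sub-term occurrences have level at most $l$, except that an abstraction $\lambda x.M$ which is the operand of a fixpoint $Y(\lambda x.M)$ is not itself counted. Configurations are tuples $(q,C,C_1,\dots,C_k)$ with $q\in Q$, $C$ a closure of type $\alpha_1\to\dots\to\alpha_k\to 0$, $C_i$ a closure of type $\alpha_i$, such that the skeletons (first components) of all these closures, and hereditarily of those in their environments, are sub-terms of $K^0$. With environments always restricted to the free variables of the skeleton, the reduction steps are $$\begin{aligned} (q,(x,\rho),\vec C)&\to\{(q,\rho(x),\vec C)\},\\ (q,(MN,\rho),\vec C)&\to\{(q,(M,\rho),(N,\rho),\vec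 C)\},\\ (q,(YM,\rho),\vec C)&\to\{(q,(M,\rho),(YM,\rho),\vec C)\},\\ (q,(\lambda x.M,\rho),C_0,\vec C)&\to\{(q,(M,\rho[x\mapsto C_0]),\vec C)\},\\ (q,(a,\rho),C_1,\dots,C_k)&\to (P_1\times\{C_1\})\cup\dots\cup(P_k\times\{C_k\})\quad\text{for each }q\xrightarrow{a}P_1\cdots P_k\text{ in }\Delta. \end{aligned}$$ **Theorem.** Every AOTPS $\mathcal S$ of order $n\ge 1$ can be encoded in an alternating Krivine machine with states $\mathcal M$ of the same level $n$, each rewriting step of $\mathcal S$ corresponding to a number of reduction steps of $\mathcal M$. That is, there are a machine $\mathcal M$ of level $n$, a function $\mathrm{enc}$ from the configurations of $\mathcal S$ to those of $\mathcal M$, and a partial function $\mathrm{dec}$ from the configurations of $\mathcal M$ to those of $\mathcal S$ (we say that $k$ represents $c$ if $\mathrm{dec}(k)=c$) such that: 1. $\mathrm{enc}(c)$ represents $c$, for every configuration $c$ of $\mathcal S$; 2. if $k$ represents $c$ and $C$ is a set of configurations of $\mathcal S$, then $c\to C$ in $\mathcal S$ if and only if there is a well-founded computation tree of $\mathcal M$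 with root $k$, consisting of at least one reduction step and cut on each branch at the first configuration after the root that represents some configuration of $\mathcal S$ (branches may also end by a transition into the empty set), such that $C$ is exactly the set of configurations represented by its leaves; 3. there is no infinite reduction path of $\mathcal M$ that starts in a configuration representing some configuration of $\mathcal S$ and never again meets such a configuration. -/

import Mathlib

universe u v

/-! ## Alternating transition systems

An alternating transition system on `C` is a relation `R : C → Set C → Prop`. -/

section Alternating

variable {C : Type*}

/-- `RunsTo R halted c K`: there is a (well-founded) computation tree of `R` with root `c` that is
cut at the first configurations satisfying `halted`, and `K` is the set of its leaves.
(A transition `R c ∅` closes a branch without contributing a leaf.) -/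
inductive RunsTo (R : C → Set C → Prop) (halted : C → Prop) : C → Set C → Prop
  | halt {c : C} : halted c → RunsTo R halted c {c}
  | step {c : C} {D : Set C} (K : C → Set C) : ¬ halted c → R c D →
      (∀ d ∈ D, RunsTo R halted d (K d)) → RunsTo R halted c (⋃ d ∈ D, K d)

/-- One or more steps of `R` from `c`, continued on every branch until the first subsequent
configuration satisfying `halted`; `K` is the set of configurations reached. -/
def MacroStep (R : C → Set C → Prop) (halted : C → Prop) (c : C) (K : Set C) : Prop :=
  ∃ (D : Set C) (L : C → Set C), R c D ∧ (∀ d ∈ D, RunsTo R halted d (L d)) ∧ K = ⋃ d ∈ D, L d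

end Alternating

/-! ## Ranked trees with variables -/

/-- Variables of trees; each has an order, and there are infinitely many of each order. -/
structure TreeVar where
  ord : ℕ
  idx : ℕ

/-- Finite ranked trees over the ranked alphabet `(Sym, rank)` with additional leaves in `V`. -/
inductive RTree {Sym : Type u} (rank : Sym → ℕ) (V : Type) : Type u
  | var (x : V) : RTree rank V
  | node (a : Sym) (ts : Fin (rank a) → RTree rank V) : RTree rank V

namespace RTree

variable {Sym : Type u} {rank : Sym → ℕ} {V W : Type}

/-- The set of variables occurring in a tree. -/
def vars : RTree rank V → Set V
  | var x => {x}
  | node _ ts => ⋃ i, (ts i).vars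

/-- Each variable occurs at most once. -/
def Linear : RTree rank V → Prop
  | var _ => True
  | node _ ts => (∀ i, (ts i).Linear) ∧ ∀ i j, i ≠ j → Disjoint (ts i).vars (ts j).vars

/-- Simultaneous substitution. -/
def subst (σ : V → RTree rank W) : RTree rank V → RTree rank W
  | var x => σ x
  | node a ts => node a fun i => (ts i).subst σ

/-- The order of a tree is the order of its root label. -/
def order (ord : Sym → ℕ) : RTree rank TreeVar → ℕ
  | var x => x.ord
  | node a _ => ord a

def IsVar (t : RTree rank V) : Prop := ∃ x, t = var x

/-- `t` is `r`-ground: it shares no variable with `r`. -/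
def GroundFor (r t : RTree rank V) : Prop := Disjoint t.vars r.vars

/-- A tree without variables, seen as a tree over the extended alphabet. -/
def emb (t : RTree rank Empty) : RTree rank TreeVar := t.subst fun x => x.elim

/-- `a(u₁, …, uₘ)` where each `uᵢ` is `r`-ground or a variable. -/
def IsShallowLhs (r l : RTree rank TreeVar) : Prop :=
  ∃ (a : Sym) (ts : Fin (rank a) → RTree rank TreeVar),
    l = node a ts ∧ ∀ i, GroundFor r (ts i) ∨ (ts i).IsVar

/-- `a(u₁, …, b(v₁, …, vₘ'), …, uₘ)` where each `uᵢ`, `vⱼ` is `r`-ground or a variable, and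
each `uᵢ` of order at most `ord b` is `r`-ground. -/
def IsDeepLhs (ord : Sym → ℕ) (r l : RTree rank TreeVar) : Prop :=
  ∃ (a : Sym) (ts : Fin (rank a) → RTree rank TreeVar) (k : Fin (rank a))
    (b : Sym) (vs : Fin (rank b) → RTree rank TreeVar),
    l = node a ts ∧ ts k = node b vs ∧
    (∀ j, GroundFor r (vs j) ∨ (vs j).IsVar) ∧
    ∀ i, i ≠ k → (GroundFor r (ts i) ∨ (ts i).IsVar) ∧
      ((ts i).order ord ≤ ord b → GroundFor r (ts i))

end RTree

/-! ## Alternating ordered tree-pushdown systems -/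

/-- A rule `p, l → S, r`. -/
structure TPRule {Sym : Type u} (rank : Sym → ℕ) (Loc : Type v) where
  src : Loc
  lhs : RTree rank TreeVar
  tgt : Set Loc
  rhs : RTree rank TreeVar

/-- Well-formed rules: `l` is linear, the variables of `r` occur in `l`, and `l` is of the shallow
or of the deep form. -/
def TPRule.WellFormed {Sym : Type u} {rank : Sym → ℕ} {Loc : Type v} (ord : Sym → ℕ)
    (ρ : TPRule rank Loc) : Prop :=
  ρ.lhs.Linear ∧ ρ.rhs.vars ⊆ ρ.lhs.vars ∧
    (RTree.IsShallowLhs ρ.rhs ρ.lhs ∨ RTree.IsDeepLhs ord ρ.rhs ρ.lhs)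

/-- Alternating ordered tree-pushdown systems of order `n`; symbols have orders `1, …, n`. -/
structure AOTPS (n : ℕ) where
  Sym : Type u
  rank : Sym → ℕ
  ord : Sym → ℕ
  Loc : Type v
  rules : Set (TPRule rank Loc)
  finite_Sym : Finite Sym
  finite_Loc : Finite Loc
  finite_rules : rules.Finite
  one_le_ord : ∀ a, 1 ≤ ord a
  ord_le : ∀ a, ord a ≤ n
  wellFormed : ∀ ρ ∈ rules, ρ.WellFormed ord

namespace AOTPS

variable {n : ℕ}

/-- Configurations `(p, t)` with `t` a tree without variables. -/
abbrev Config (S : AOTPS.{u, v} n) : Type (max u v) := S.Loc × RTree S.rank Empty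

/-- Root rewriting: `(p, lσ) → S × {rσ}` for a rule `p, l → S, r` and an order-preserving
substitution `σ` (total functions here; those which move finitely many variables suffice). -/
def Step (S : AOTPS.{u, v} n) (c : S.Config) (C : Set S.Config) : Prop :=
  ∃ ρ ∈ S.rules, ∃ (σ : TreeVar → RTree S.rank TreeVar) (t' : RTree S.rank Empty),
    (∀ x, (σ x).order S.ord = x.ord) ∧
    c.1 = ρ.src ∧ c.2.emb = ρ.lhs.subst σ ∧ t'.emb = ρ.rhs.subst σ ∧
    C = {d | d.1 ∈ ρ.tgt ∧ d.2 = t'}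

end AOTPS

/-! ## Simply typed terms with fixpoints -/

inductive STy : Type
  | base : STy
  | arr (α β : STy) : STy

def STy.level : STy → ℕ
  | base => 0
  | arr α β => max (α.level + 1) β.level

/-- The type `0ᵏ → 0`. -/
def STy.const : ℕ → STy
  | 0 => base
  | k + 1 => arr base (STy.const k)

/-- Typed variables; countably many of each type. -/
structure LVar where
  ty : STy
  idx : ℕ

/-- Simply typed lambda-terms with fixpoints over the ranked alphabet `(Γ, rank)`, indexed by
their type. -/
inductive LTerm {Γ : Type} (rank : Γ → ℕ) : STy → Type
  | const (a : Γ) : LTerm rank (STy.const (rank a))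
  | var (x : LVar) : LTerm rank x.ty
  | lam (x : LVar) {β : STy} (M : LTerm rank β) : LTerm rank (STy.arr x.ty β)
  | app {α β : STy} (M : LTerm rank (STy.arr α β)) (N : LTerm rank α) : LTerm rank β
  | fix {α : STy} (M : LTerm rank (STy.arr α α)) : LTerm rank α

namespace LTerm

variable {Γ : Type} {rank : Γ → ℕ}

/-- Free variables. -/
def fv : {α : STy} → LTerm rank α → Set LVar
  | _, const _ => ∅
  | _, var x => {x}
  | _, lam x M => M.fv \ {x}
  | _, app M N => M.fv ∪ N.fv
  | _, fix M => M.fv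

/-- `IsSubterm N K`: `N` is a sub-term of `K`. -/
inductive IsSubterm : {α β : STy} → LTerm rank α → LTerm rank β → Prop
  | refl {α : STy} (N : LTerm rank α) : IsSubterm N N
  | lam {α β : STy} {N : LTerm rank α} (x : LVar) {M : LTerm rank β} :
      IsSubterm N M → IsSubterm N (lam x M)
  | app_left {α β γ : STy} {N : LTerm rank α} {M : LTerm rank (STy.arr β γ)}
      {M' : LTerm rank β} : IsSubterm N M → IsSubterm N (app M M')
  | app_right {α β γ : STy} {N : LTerm rank α} {M : LTerm rank (STy.arr β γ)}
      {M' : LTerm rank β} : IsSubterm N M' → IsSubterm N (app M M')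
  | fix {α β : STy} {N : LTerm rank α} {M : LTerm rank (STy.arr β β)} :
      IsSubterm N M → IsSubterm N (fix M)

/-- All (occurrences of) sub-terms have level at most `l`, where in a fixpoint `Y (λx. M)` the
abstraction `λx. M` itself is not counted (i.e. `Y (λx. M)` is treated like a single fixpoint
binder `Yx. M`). -/
inductive LevelAtMost (l : ℕ) : {α : STy} → LTerm rank α → Prop
  | const (a : Γ) : (STy.const (rank a)).level ≤ l → LevelAtMost l (const a)
  | var (x : LVar) : x.ty.level ≤ l → LevelAtMost l (var x)
  | lam (x : LVar) {β : STy} {M : LTerm rank β} : (STy.arr x.ty β).level ≤ l →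
      LevelAtMost l M → LevelAtMost l (lam x M)
  | app {α β : STy} {M : LTerm rank (STy.arr α β)} {N : LTerm rank α} : β.level ≤ l →
      LevelAtMost l M → LevelAtMost l N → LevelAtMost l (app M N)
  | fix {α : STy} {M : LTerm rank (STy.arr α α)} : α.level ≤ l →
      LevelAtMost l M → LevelAtMost l (fix M)
  | fix_lam (x : LVar) {M : LTerm rank x.ty} : x.ty.level ≤ l →
      LevelAtMost l M → LevelAtMost l (fix (lam x M))

end LTerm

/-! ## The Krivine machine with states -/

/-- Valid closures `(M, ρ)`: the environment `ρ` assigns a valid closure of the right type to each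
free variable of `M`, and binds no other variable. -/
inductive Closure {Γ : Type} (rank : Γ → ℕ) : STy → Type
  | mk {α : STy} (M : LTerm rank α) (ρ : ∀ x ∈ M.fv, Closure rank x.ty) : Closure rank α

/-- The environment `ρ[x ↦ C]`, restricted to the free variables of `M`, where `ρ` binds the free
variables of `λx. M`. -/
noncomputable def extendEnv {Γ : Type} {rank : Γ → ℕ} (x : LVar) {β : STy} (M : LTerm rank β)
    (ρ : ∀ y ∈ (LTerm.lam x M).fv, Closure rank y.ty) (C : Closure rank x.ty) :
    ∀ y ∈ M.fv, Closure rank y.ty :=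
  open Classical in
  fun y hy => if h : y = x then cast (by rw [h]) C else ρ y ⟨hy, h⟩

/-- Lists of argument closures `C₁, …, Cₖ` of types `α₁, …, αₖ`, for the type
`α₁ → ⋯ → αₖ → 0`. -/
inductive ArgList {Γ : Type} (rank : Γ → ℕ) : STy → Type
  | nil : ArgList rank STy.base
  | cons {α β : STy} (C : Closure rank α) (Cs : ArgList rank β) : ArgList rank (STy.arr α β)

/-- The `i`-th argument in a list `C₁, …, Cₖ` for the type `0ᵏ → 0`. -/
def ArgList.get {Γ : Type} {rank : Γ → ℕ} :
    (k : ℕ) → ArgList rank (STy.const k) → Fin k → Closure rank STy.base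
  | 0, _, i => i.elim0
  | k + 1, .cons C Cs, i => Fin.cases C (ArgList.get k Cs) i

/-- The skeletons of the closure and, hereditarily, of those in its environment are sub-terms of
`K`. -/
def Closure.Over {Γ : Type} {rank : Γ → ℕ} (K : LTerm rank STy.base) :
    {α : STy} → Closure rank α → Prop
  | _, .mk M ρ => LTerm.IsSubterm M K ∧ ∀ x hx, (ρ x hx).Over K

def ArgList.Over {Γ : Type} {rank : Γ → ℕ} (K : LTerm rank STy.base) :
    {α : STy} → ArgList rank α → Prop
  | _, .nil => True
  | _, .cons C Cs => C.Over K ∧ Cs.Over K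

/-- Alternating Krivine machines with states of level `l`. The letters of `(Γ, rank)` are the
constants, and `(p, a, P₁ ⋯ Pₖ) ∈ Δ` are the transitions of an alternating tree automaton. -/
structure KrivineMachine (l : ℕ) where
  Γ : Type
  rank : Γ → ℕ
  Q : Type
  Δ : Set (Q × (Σ a : Γ, Fin (rank a) → Set Q))
  K₀ : LTerm rank STy.base
  finite_Γ : Finite Γ
  finite_Q : Finite Q
  closed : K₀.fv = ∅
  level_le : K₀.LevelAtMost l

/-- Tuples `(p, C, C₁, …, Cₖ)` with `C` of type `α₁ → ⋯ → αₖ → 0` and `Cᵢ` of type `αᵢ`. -/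
structure KConfig {Γ : Type} (rank : Γ → ℕ) (Q : Type) where
  state : Q
  {ty : STy}
  head : Closure rank ty
  args : ArgList rank ty

/-- The reduction steps. -/
inductive KStep {Γ : Type} {rank : Γ → ℕ} {Q : Type}
    (Δ : Set (Q × (Σ a : Γ, Fin (rank a) → Set Q))) :
    KConfig rank Q → Set (KConfig rank Q) → Prop
  | var (p : Q) (x : LVar) (ρ : ∀ y ∈ (LTerm.var (rank := rank) x).fv, Closure rank y.ty)
      (Cs : ArgList rank x.ty) :
      KStep Δ ⟨p, .mk (.var x) ρ, Cs⟩ {⟨p, ρ x rfl, Cs⟩}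
  | app (p : Q) {α β : STy} (M : LTerm rank (STy.arr α β)) (N : LTerm rank α)
      (ρ : ∀ y ∈ (LTerm.app M N).fv, Closure rank y.ty) (Cs : ArgList rank β) :
      KStep Δ ⟨p, .mk (.app M N) ρ, Cs⟩
        {⟨p, .mk M fun y hy => ρ y (Or.inl hy), .cons (.mk N fun y hy => ρ y (Or.inr hy)) Cs⟩}
  | fix (p : Q) {α : STy} (M : LTerm rank (STy.arr α α))
      (ρ : ∀ y ∈ (LTerm.fix M).fv, Closure rank y.ty) (Cs : ArgList rank α) :
      KStep Δ ⟨p, .mk (.fix M) ρ, Cs⟩ {⟨p, .mk M ρ, .cons (.mk (.fix M) ρ) Cs⟩}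
  | lam (p : Q) (x : LVar) {β : STy} (M : LTerm rank β)
      (ρ : ∀ y ∈ (LTerm.lam x M).fv, Closure rank y.ty) (C : Closure rank x.ty)
      (Cs : ArgList rank β) :
      KStep Δ ⟨p, .mk (.lam x M) ρ, .cons C Cs⟩ {⟨p, .mk M (extendEnv x M ρ C), Cs⟩}
  | const (p : Q) (a : Γ) (P : Fin (rank a) → Set Q)
      (ρ : ∀ y ∈ (LTerm.const (rank := rank) a).fv, Closure rank y.ty)
      (Cs : ArgList rank (STy.const (rank a))) :
      (p, ⟨a, P⟩) ∈ Δ →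
      KStep Δ ⟨p, .mk (.const a) ρ, Cs⟩
        {d | ∃ i, ∃ q ∈ P i, d = ⟨q, ArgList.get (rank a) Cs i, .nil⟩}

namespace KrivineMachine

variable {l : ℕ}

/-- The configurations of the machine: all closures are over the sub-terms of `K₀`. -/
abbrev Config (M : KrivineMachine l) : Type :=
  {c : KConfig M.rank M.Q // c.head.Over M.K₀ ∧ c.args.Over M.K₀}

/-- The alternating transition relation of the machine. -/
def Step (M : KrivineMachine l) (c : M.Config) (D : Set M.Config) : Prop :=
  KStep M.Δ c.1 (Subtype.val '' D)

end KrivineMachine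

/-! ## Encodings -/

/-- `enc` and `dec` encode the system `S` in the machine `M`. A machine configuration `k` with
`dec k = some c` is a representation of `c`; several ones may represent the same `c`.
* `enc c` represents `c`.
* If `k` represents `c`, then the transitions of `S` from `c` are exactly what the sequences of one
  or more reduction steps of `M` do that start in `k` and are followed, on every branch, until the
  first configuration that again represents a configuration of `S`.
* No infinite reduction path that starts in a representation avoids representations for ever. -/
structure IsEncoding {n l : ℕ} (S : AOTPS.{u, v} n) (M : KrivineMachine l)
    (enc : S.Config → M.Config) (dec : M.Config → Option S.Config) : Prop where
  dec_enc : ∀ c, dec (enc c) = some c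
  step_iff : ∀ k c, dec k = some c → ∀ C : Set S.Config,
    S.Step c C ↔ ∃ K, MacroStep M.Step (fun k' => (dec k').isSome) k K ∧
      C = {c' | ∃ k' ∈ K, dec k' = some c'}
  terminates : ∀ k : ℕ → M.Config, (dec (k 0)).isSome →
    (∀ i, ∃ D, M.Step (k i) D ∧ k (i + 1) ∈ D) → ∃ i, (dec (k (i + 1))).isSome

/-!
The machine represents trees by closures, and it simulates a rewriting step at the root by running
the closure of the root in a state that carries the control location.

A tree of order `o` becomes a closure of type `treeTy m (n - o)`, a function that takes `m` trees of
each order larger than `o`, where `m` bounds the ranks; this type has level at most `n - o`. When a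
deep rule goes from a node `a` to its child with label `b`, the machine runs the closure of the child
and passes the other children of `a` of order larger than `ord b` as arguments. By the ordering
condition these are the only other children that the right-hand side may use, and it is then built
at the child, where its variables are the children of `b` and the inherited trees.

All nodes are made by a single fixpoint `ctorTerm`, a universal constructor with one position for each
child and each possible depth of the child. The fixpoint has level `n`, and it closes the loop
between rules and nodes: the body of the constructor lists the right-hand sides of all rules, which
call the constructor. The node term `nodeTerm` first announces the label of the node and the depths
of its children by a constant `tag i`, which the machine stores in its state; then the body,
headed by the constant `sel`, lets the machine choose a continuation. For a rule, alternation makes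
the machine match all children against the patterns of the left-hand side, on branches that
end in the empty set, and at the same time proceed to the right-hand side. Since the label is known
before anything is launched, the trees that are launched are always well formed, even if matching
fails on another branch; therefore a representing configuration is always reached (`terminating_main`).

The representation is defined by behaviour: `Builds` says that a closure announces the type of the
root and opens to an environment which, by `Holds`, holds the children. As silent reduction is
deterministic, a closure builds at most one tree (`holds_unique`). The terms of the machine build
the trees that they stand for (`builds_nodeTerm`, `builds_treeTerm`), and the right-hand sides are
built from the environments that are at hand (`builds_rhs_shallow`, `builds_rhs_deep`). Computation
trees are then evaluated by `yields_main_iff`, which uses `decidesMatch` for the matching branches.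
-/

namespace OrderedPushdown

/-! ### Closures with total environments and silent reduction -/

section Machine

variable {Γ : Type} {rank : Γ → ℕ} {Q : Type}

/-- Environments defined on all variables. A closure only reads the values on the free variables of
its skeleton, see `clo`. -/
abbrev Env (rank : Γ → ℕ) : Type := ∀ x : LVar, Closure rank x.ty

/-- The closure of `M` in the total environment `E`, restricted to the free variables of `M`. -/
def clo {α : STy} (M : LTerm rank α) (E : Env rank) : Closure rank α :=
  .mk M fun x _ => E x

theorem clo_congr {α : STy} {M : LTerm rank α} {E E' : Env rank}
    (h : ∀ x ∈ M.fv, E x = E' x) : clo M E = clo M E' := by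
  unfold clo
  congr 1
  funext x hx
  exact h x hx

theorem eq_of_clo_eq {α : STy} {M : LTerm rank α} {E E' : Env rank}
    (h : clo M E = clo M E') : ∀ x ∈ M.fv, E x = E' x := by
  intro x hx
  unfold clo at h
  injection h with _ _ h
  exact congrFun (congrFun h x) hx

open Classical in
theorem extendEnv_restrict (x : LVar) {β : STy} (M : LTerm rank β) (E : Env rank)
    (C : Closure rank x.ty) :
    extendEnv x M (fun y _ => E y) C = fun y _ => Function.update E x C y := by
  funext y hy
  by_cases h : y = x
  · subst h
    simp [extendEnv]
  · simp [extendEnv, h]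

/-- The reduction steps other than those at a constant, as a partial function. Such a step does not
depend on the transitions of the machine and has exactly one successor. -/
noncomputable def silent : KConfig rank Q → Option (KConfig rank Q)
  | ⟨p, .mk (.var x) ρ, Cs⟩ => some ⟨p, ρ x rfl, Cs⟩
  | ⟨p, .mk (.app M N) ρ, Cs⟩ =>
      some ⟨p, .mk M fun y hy => ρ y (Or.inl hy), .cons (.mk N fun y hy => ρ y (Or.inr hy)) Cs⟩
  | ⟨p, .mk (.fix M) ρ, Cs⟩ => some ⟨p, .mk M ρ, .cons (.mk (.fix M) ρ) Cs⟩
  | ⟨p, .mk (.lam x M) ρ, .cons C Cs⟩ => some ⟨p, .mk M (extendEnv x M ρ C), Cs⟩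
  | ⟨_, .mk (.const _) _, _⟩ => none

/-- The successor relation of `KStep`, by case distinction on the skeleton of the head. -/
def Next (Δ : Set (Q × (Σ a : Γ, Fin (rank a) → Set Q))) (D : Set (KConfig rank Q)) :
    KConfig rank Q → Prop
  | ⟨p, .mk (.const a) _, Cs⟩ => ∃ P : Fin (rank a) → Set Q, (p, ⟨a, P⟩) ∈ Δ ∧
      D = {d | ∃ i, ∃ q ∈ P i, d = ⟨q, ArgList.get (rank a) Cs i, .nil⟩}
  | k => ∃ k', silent k = some k' ∧ D = {k'}

/-- Inversion of `KStep`. Case distinction on a step with a given source is obstructed by the type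
indices, since `STy.const (rank a)` does not unify with other types; `Next` avoids this. -/
theorem kStep_iff_next {Δ : Set (Q × (Σ a : Γ, Fin (rank a) → Set Q))}
    {k : KConfig rank Q} {D : Set (KConfig rank Q)} : KStep Δ k D ↔ Next Δ D k := by
  constructor
  · intro h
    cases h with
    | const p a P ρ Cs hP => exact ⟨P, hP, rfl⟩
    | _ => exact ⟨_, rfl, rfl⟩
  · obtain ⟨p, ⟨M, ρ⟩, Cs⟩ := k
    cases M with
    | const a =>
      rintro ⟨P, hP, rfl⟩
      exact .const p a P ρ Cs hP
    | var x => rintro ⟨k', h, rfl⟩; cases h; exact .var ..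
    | app M N => rintro ⟨k', h, rfl⟩; cases h; exact .app ..
    | fix M => rintro ⟨k', h, rfl⟩; cases h; exact .fix ..
    | lam x M =>
      cases Cs with
      | cons C Cs => rintro ⟨k', h, rfl⟩; cases h; exact .lam ..

theorem kStep_silent {Δ : Set (Q × (Σ a : Γ, Fin (rank a) → Set Q))}
    {k k' : KConfig rank Q} (h : silent k = some k') {D : Set (KConfig rank Q)} :
    KStep Δ k D ↔ D = {k'} := by
  rw [kStep_iff_next]
  obtain ⟨p, ⟨M, ρ⟩, Cs⟩ := k
  cases M with
  | const a => cases h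
  | lam x M =>
    cases Cs with
    | cons C Cs => cases h; exact ⟨fun ⟨_, h, e⟩ => by cases h; exact e, fun e => ⟨_, rfl, e⟩⟩
  | _ => cases h; exact ⟨fun ⟨_, h, e⟩ => by cases h; exact e, fun e => ⟨_, rfl, e⟩⟩

theorem kStep_const {Δ : Set (Q × (Σ a : Γ, Fin (rank a) → Set Q))}
    {q : Q} {a : Γ} {E : Env rank} {Cs : ArgList rank (STy.const (rank a))}
    {D : Set (KConfig rank Q)} :
    KStep Δ ⟨q, clo (.const a) E, Cs⟩ D ↔ ∃ P : Fin (rank a) → Set Q, (q, ⟨a, P⟩) ∈ Δ ∧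
      D = {d | ∃ i, ∃ q ∈ P i, d = ⟨q, ArgList.get (rank a) Cs i, .nil⟩} :=
  kStep_iff_next

/-- Sequences of silent reduction steps. -/
abbrev Steps : KConfig rank Q → KConfig rank Q → Prop :=
  Relation.ReflTransGen fun k k' => silent k = some k'

theorem Steps.unique {k a b : KConfig rank Q} (ha : Steps k a) (hb : Steps k b)
    (hsa : silent a = none) (hsb : silent b = none) : a = b := by
  induction ha using Relation.ReflTransGen.head_induction_on with
  | refl =>
    cases hb using Relation.ReflTransGen.head_induction_on with
    | refl => rfl
    | head h _ _ => rw [hsa] at h; cases h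
  | head h _ ih =>
    apply ih
    cases hb using Relation.ReflTransGen.head_induction_on with
    | refl => rw [hsb] at h; cases h
    | head h' hb _ =>
      rw [h] at h'
      cases h'
      exact hb

theorem steps_var (q : Q) (x : LVar) (E : Env rank) (Cs : ArgList rank x.ty) :
    Steps (⟨q, clo (.var x) E, Cs⟩ : KConfig rank Q) ⟨q, E x, Cs⟩ := .single rfl

theorem steps_app (q : Q) {α β : STy} (M : LTerm rank (STy.arr α β)) (N : LTerm rank α)
    (E : Env rank) (Cs : ArgList rank β) :
    Steps (⟨q, clo (.app M N) E, Cs⟩ : KConfig rank Q) ⟨q, clo M E, .cons (clo N E) Cs⟩ :=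
  .single rfl

theorem steps_fix (q : Q) {α : STy} (M : LTerm rank (STy.arr α α))
    (E : Env rank) (Cs : ArgList rank α) :
    Steps (⟨q, clo (.fix M) E, Cs⟩ : KConfig rank Q) ⟨q, clo M E, .cons (clo (.fix M) E) Cs⟩ :=
  .single rfl

open Classical in
theorem steps_lam (q : Q) (x : LVar) {β : STy} (M : LTerm rank β) (E : Env rank)
    (C : Closure rank x.ty) (Cs : ArgList rank β) :
    Steps (⟨q, clo (.lam x M) E, .cons C Cs⟩ : KConfig rank Q)
      ⟨q, clo M (Function.update E x C), Cs⟩ := by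
  refine .single ?_
  show some (_ : KConfig rank Q) = _
  rw [extendEnv_restrict]
  rfl

/-! ### Skeletons stay among the sub-terms -/

theorem isSubterm_trans {α β γ : STy} {A : LTerm rank α} {B : LTerm rank β} {C : LTerm rank γ}
    (h : LTerm.IsSubterm A B) (h' : LTerm.IsSubterm B C) : LTerm.IsSubterm A C := by
  induction h' with
  | refl => exact h
  | lam x _ ih => exact .lam x (ih h)
  | app_left _ ih => exact .app_left (ih h)
  | app_right _ ih => exact .app_right (ih h)
  | fix _ ih => exact .fix (ih h)

/-- All skeletons in `k` are, hereditarily, sub-terms of `K`. -/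
def OverConfig (K : LTerm rank STy.base) (k : KConfig rank Q) : Prop :=
  k.head.Over K ∧ k.args.Over K

theorem over_clo {K : LTerm rank STy.base} {α : STy} {M : LTerm rank α} {E : Env rank} :
    (clo M E).Over K ↔ LTerm.IsSubterm M K ∧ ∀ x ∈ M.fv, (E x).Over K := by
  unfold clo
  rw [Closure.Over]

theorem over_get {K : LTerm rank STy.base} : ∀ (k : ℕ) (Cs : ArgList rank (STy.const k)) (i : Fin k),
    Cs.Over K → (ArgList.get k Cs i).Over K
  | 0, _, i, _ => i.elim0
  | k + 1, .cons C Cs, i, h => by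
    refine Fin.cases ?_ (fun i => ?_) i
    · exact h.1
    · exact over_get k Cs i h.2

theorem over_silent {K : LTerm rank STy.base} {k k' : KConfig rank Q}
    (h : silent k = some k') (hk : OverConfig K k) : OverConfig K k' := by
  obtain ⟨p, ⟨M, ρ⟩, Cs⟩ := k
  obtain ⟨h1, h2⟩ := hk
  simp only [Closure.Over] at h1
  obtain ⟨hM, hρ⟩ := h1
  cases M with
  | const a => cases h
  | var x => cases h; exact ⟨hρ _ _, h2⟩
  | app M N =>
    cases h
    refine ⟨?_, ?_, h2⟩
    · simp only [Closure.Over]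
      exact ⟨isSubterm_trans (.app_left (.refl _)) hM, fun x hx => hρ _ _⟩
    · simp only [Closure.Over]
      exact ⟨isSubterm_trans (.app_right (.refl _)) hM, fun x hx => hρ _ _⟩
  | fix M =>
    cases h
    refine ⟨?_, ?_, h2⟩
    · simp only [Closure.Over]
      exact ⟨isSubterm_trans (.fix (.refl _)) hM, fun x hx => hρ _ _⟩
    · simp only [Closure.Over]
      exact ⟨hM, fun x hx => hρ _ _⟩
  | lam x M =>
    cases Cs with
    | cons C Cs =>
      cases h
      refine ⟨?_, h2.2⟩
      simp only [Closure.Over]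
      refine ⟨isSubterm_trans (.lam x (.refl _)) hM, fun y hy => ?_⟩
      by_cases hyx : y = x
      · subst hyx
        simpa [extendEnv] using h2.1
      · simpa [extendEnv, hyx] using hρ _ _

theorem over_steps {K : LTerm rank STy.base} {k k' : KConfig rank Q}
    (h : Steps k k') (hk : OverConfig K k) : OverConfig K k' := by
  induction h with
  | refl => exact hk
  | tail _ h ih => exact over_silent h ih

theorem over_kStep {K : LTerm rank STy.base} {Δ : Set (Q × (Σ a : Γ, Fin (rank a) → Set Q))}
    {k : KConfig rank Q} {D : Set (KConfig rank Q)} (h : KStep Δ k D) (hk : OverConfig K k) :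
    ∀ d ∈ D, OverConfig K d := by
  intro d hd
  cases hs : silent k with
  | some k' =>
    rw [(kStep_silent hs).1 h] at hd
    rw [hd]
    exact over_silent hs hk
  | none =>
    cases h with
    | const p a P ρ Cs hP =>
      obtain ⟨i, q, _, rfl⟩ := hd
      exact ⟨over_get _ _ _ hk.2, trivial⟩
    | _ => cases hs

end Machine

/-! ### Computation trees and the restriction to sub-term skeletons -/

section Transfer

variable {l : ℕ} {M : KrivineMachine l}

/-- A step of the unrestricted relation from a configuration of `M` stays in the configurations
of `M`. -/
theorem step_iff_kStep {c : M.Config} {D : Set (KConfig M.rank M.Q)} (h : KStep M.Δ c.1 D) :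
    M.Step c (Subtype.val ⁻¹' D) ∧ Subtype.val '' (Subtype.val ⁻¹' D : Set M.Config) = D := by
  have : Subtype.val '' (Subtype.val ⁻¹' D : Set M.Config) = D := by
    exact Set.image_preimage_eq_of_subset fun d hd => ⟨⟨d, over_kStep h c.2 d hd⟩, rfl⟩
  refine ⟨?_, this⟩
  unfold KrivineMachine.Step
  rwa [this]

open Classical in
/-- Computation trees of `M` are computation trees of the unrestricted relation. -/
theorem runsTo_forget {halted : KConfig M.rank M.Q → Prop} {c : M.Config} {K : Set M.Config}
    (h : RunsTo M.Step (fun k => halted k.1) c K) :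
    RunsTo (KStep M.Δ) halted c.1 (Subtype.val '' K) := by
  induction h with
  | halt h => rw [Set.image_singleton]; exact .halt h
  | @step c D K hc hstep hD ih =>
    have := RunsTo.step (R := KStep M.Δ) (halted := halted) (c := c.1) (D := Subtype.val '' D)
      (fun d => if hd : _ then Subtype.val '' K ⟨d, hd⟩ else ∅) hc hstep (by
        rintro _ ⟨d, hd, rfl⟩
        simp only [d.2]
        exact ih d hd)
    convert this using 1
    ext x
    simp only [Set.mem_image, Set.mem_iUnion]
    constructor
    · rintro ⟨y, ⟨d, hd, hy⟩, rfl⟩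
      refine ⟨d.1, ⟨d, hd, rfl⟩, ?_⟩
      rw [dif_pos d.2]
      exact ⟨y, hy, rfl⟩
    · rintro ⟨_, ⟨d, hd, rfl⟩, hx⟩
      rw [dif_pos d.2] at hx
      obtain ⟨y, hy, rfl⟩ := hx
      exact ⟨y, ⟨d, hd, hy⟩, rfl⟩

/-- Computation trees of the unrestricted relation that start in a configuration of `M` are
computation trees of `M`. -/
theorem runsTo_lift {halted : KConfig M.rank M.Q → Prop} {c : KConfig M.rank M.Q}
    {K : Set (KConfig M.rank M.Q)} (h : RunsTo (KStep M.Δ) halted c K) :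
    ∀ hc : c.head.Over M.K₀ ∧ c.args.Over M.K₀, ∃ K' : Set M.Config,
      RunsTo M.Step (fun k => halted k.1) ⟨c, hc⟩ K' ∧ Subtype.val '' K' = K := by
  induction h with
  | @halt c h => exact fun hc => ⟨{⟨c, hc⟩},
      RunsTo.halt (R := M.Step) (halted := fun k : M.Config => halted k.1) (c := ⟨c, hc⟩) h, by simp⟩
  | @step c D K hn hstep hD ih =>
    intro hc
    obtain ⟨h1, h2⟩ := step_iff_kStep (c := ⟨c, hc⟩) hstep
    have key : ∀ d : M.Config, ∃ K' : Set M.Config, d.1 ∈ D →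
        RunsTo M.Step (fun k => halted k.1) d K' ∧ Subtype.val '' K' = K d.1 := by
      intro d
      by_cases hd : d.1 ∈ D
      · obtain ⟨K', h⟩ := ih d.1 hd d.2
        exact ⟨K', fun _ => h⟩
      · exact ⟨∅, fun h => absurd h hd⟩
    choose L hL using key
    refine ⟨⋃ d ∈ (Subtype.val ⁻¹' D : Set M.Config), L d,
      .step L hn h1 fun d hd => (hL d hd).1, ?_⟩
    rw [Set.image_iUnion₂]
    conv_rhs => rw [← h2]
    rw [Set.biUnion_image]
    exact Set.iUnion₂_congr fun d hd => (hL d hd).2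

end Transfer

/-! ### The types of trees -/

section Types

/-- The type `αᵏ → β`. Reducible, so that iterated applications are type-correct for `rw`. -/
@[reducible]
def arrPow (k : ℕ) (α β : STy) : STy :=
  match k with
  | 0 => β
  | k + 1 => .arr α (arrPow k α β)

/-- `arrs m d β` is `T (d-1)ᵐ → ⋯ → T 0ᵐ → β`, where `T d = arrs m d base`. -/
@[reducible]
def arrs (m : ℕ) : ℕ → STy → STy
  | 0, β => β
  | d + 1, β => arrPow m (arrs m d .base) (arrs m d β)

/-- The type `T d = T (d-1)ᵐ → ⋯ → T 0ᵐ → 0` of trees at depth `d`, i.e. of order `n - d`: such a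
tree expects `m` trees of each higher order. Its level is at most `d`. -/
abbrev treeTy (m d : ℕ) : STy := arrs m d .base

theorem level_arrPow_le (k : ℕ) (α β : STy) :
    (arrPow k α β).level ≤ max (α.level + 1) β.level := by
  induction k with
  | zero => exact le_max_right _ _
  | succ k ih => simp only [STy.level]; omega

theorem level_arrs_le (m : ℕ) : ∀ (d : ℕ) (β : STy), (arrs m d β).level ≤ max d β.level
  | 0, β => by simp [arrs]
  | d + 1, β => by
    have h1 := level_arrPow_le m (arrs m d .base) (arrs m d β)
    have h2 := level_arrs_le m d .base
    have h3 := level_arrs_le m d β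
    simp only [arrs]
    simp only [STy.level] at h2
    omega

theorem level_treeTy_le (m d : ℕ) : (treeTy m d).level ≤ d := by
  have := level_arrs_le m d .base
  simpa [STy.level] using this

theorem level_const_le (k : ℕ) : (STy.const k).level ≤ 1 := by
  induction k with
  | zero => simp [STy.const, STy.level]
  | succ k ih => simp only [STy.const, STy.level]; omega

end Types

section Spines

variable {Γ : Type} {rank : Γ → ℕ} {Q : Type}

/-! ### Filling argument positions -/

/-- A closed term of type `α`, used to fill argument positions that are never looked at. -/
def dummy (α : STy) : LTerm rank α := .fix (.lam ⟨α, 0⟩ (.var ⟨α, 0⟩))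

/-- `M` applied to dummies, up to type `0`. -/
def saturate : (α : STy) → LTerm rank α → LTerm rank .base
  | .base, M => M
  | .arr α β, M => saturate β (.app M (dummy α))

/-- The environment all of whose values are dummies. -/
noncomputable def dummyEnv : Env rank := fun x => .mk (dummy x.ty) fun _ h => absurd h.1 h.2

/-- The argument list of dummies. -/
noncomputable def dummyArgs : (α : STy) → ArgList rank α
  | .base => .nil
  | .arr α β => .cons (clo (dummy α) dummyEnv) (dummyArgs β)

/-! ### Iterated application, abstraction and argument lists -/

variable {m : ℕ} {α β : STy}

/-- `M (f (k-1)) ⋯ (f 0)`. -/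
def appPow : (k : ℕ) → LTerm rank (arrPow k α β) → (ℕ → LTerm rank α) → LTerm rank β
  | 0, M, _ => M
  | k + 1, M, f => appPow k (.app M (f k)) f

/-- `M` applied to `f d' (m-1), …, f d' 0` for `d' = d-1, …, 0`. -/
def apps : (d : ℕ) → LTerm rank (arrs m d β) → (∀ d', ℕ → LTerm rank (treeTy m d')) →
    LTerm rank β
  | 0, M, _ => M
  | d + 1, M, f => apps d (appPow m M (f d)) f

/-- Abstraction over the `k` variables of type `α` named `v (k-1), …, v 0`. -/
def lamPow (v : ℕ → ℕ) : (k : ℕ) → LTerm rank β → LTerm rank (arrPow k α β)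
  | 0, M => M
  | k + 1, M => .lam ⟨α, v k⟩ (lamPow v k M)

/-- Abstraction over the variables of type `treeTy m d'` named `v d' j`, in the order of `apps`. -/
def lams (v : ℕ → ℕ → ℕ) : (d : ℕ) → LTerm rank β → LTerm rank (arrs m d β)
  | 0, M => M
  | d + 1, M => lamPow (v d) m (lams v d M)

/-- The argument list `f (k-1), …, f 0` followed by `Cs`. -/
def pushPow : (k : ℕ) → (ℕ → Closure rank α) → ArgList rank β → ArgList rank (arrPow k α β)
  | 0, _, Cs => Cs
  | k + 1, f, Cs => .cons (f k) (pushPow k f Cs)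

/-- The argument list `f d' (m-1), …, f d' 0` for `d' = d-1, …, 0`, followed by `Cs`. -/
def pushes : (d : ℕ) → (∀ d', ℕ → Closure rank (treeTy m d')) → ArgList rank β →
    ArgList rank (arrs m d β)
  | 0, _, Cs => Cs
  | d + 1, f, Cs => pushPow m (f d) (pushes d f Cs)

/-- `M (f 0) ⋯ (f (k-1))` for `M` of type `0ᵏ → 0`. -/
def appConst : (k : ℕ) → LTerm rank (STy.const k) → (Fin k → LTerm rank .base) → LTerm rank .base
  | 0, M, _ => M
  | k + 1, M, f => appConst k (.app M (f 0)) fun i => f i.succ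

/-- The argument list `f 0, …, f (k-1)` for the type `0ᵏ → 0`. -/
def pushConst : (k : ℕ) → (Fin k → Closure rank .base) → ArgList rank (STy.const k)
  | 0, _ => .nil
  | k + 1, f => .cons (f 0) (pushConst k fun i => f i.succ)

theorem get_pushConst : ∀ (k : ℕ) (f : Fin k → Closure rank .base) (i : Fin k),
    ArgList.get k (pushConst k f) i = f i
  | 0, _, i => i.elim0
  | k + 1, f, i => by
    refine Fin.cases ?_ (fun i => ?_) i
    · rfl
    · exact get_pushConst k _ i

/-! ### Reductions of iterated applications and abstractions -/

theorem steps_appPow (q : Q) (E : Env rank) (f : ℕ → LTerm rank α) (Cs : ArgList rank β) :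
    ∀ (k : ℕ) (M : LTerm rank (arrPow k α β)),
      Steps (⟨q, clo (appPow k M f) E, Cs⟩ : KConfig rank Q)
        ⟨q, clo M E, pushPow k (fun j => clo (f j) E) Cs⟩
  | 0, _ => .refl
  | k + 1, M => (steps_appPow q E f Cs k (.app M (f k))).trans (steps_app ..)

theorem steps_apps (q : Q) (E : Env rank) (f : ∀ d', ℕ → LTerm rank (treeTy m d'))
    (Cs : ArgList rank β) : ∀ (d : ℕ) (M : LTerm rank (arrs m d β)),
      Steps (⟨q, clo (apps d M f) E, Cs⟩ : KConfig rank Q)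
        ⟨q, clo M E, pushes d (fun d' j => clo (f d' j) E) Cs⟩
  | 0, _ => .refl
  | d + 1, M => (steps_apps q E f Cs d (appPow m M (f d))).trans (steps_appPow ..)

theorem steps_appConst (q : Q) (E : Env rank) :
    ∀ (k : ℕ) (M : LTerm rank (STy.const k)) (f : Fin k → LTerm rank .base),
      Steps (⟨q, clo (appConst k M f) E, .nil⟩ : KConfig rank Q)
        ⟨q, clo M E, pushConst k fun i => clo (f i) E⟩
  | 0, _, _ => .refl
  | k + 1, M, f => (steps_appConst q E k (.app M (f 0)) _).trans (steps_app ..)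

theorem fv_dummy (α : STy) : (dummy α : LTerm rank α).fv = ∅ := by
  simp [dummy, LTerm.fv]

theorem clo_dummy (α : STy) (E E' : Env rank) : clo (dummy α) E = clo (dummy α) E' :=
  clo_congr fun x hx => by rw [fv_dummy] at hx; exact hx.elim

theorem steps_saturate (q : Q) (E : Env rank) : ∀ (α : STy) (M : LTerm rank α),
    Steps (⟨q, clo (saturate α M) E, .nil⟩ : KConfig rank Q) ⟨q, clo M E, dummyArgs α⟩
  | .base, _ => .refl
  | .arr α β, M => by
    refine (steps_saturate q E β _).trans ?_
    rw [dummyArgs, clo_dummy α dummyEnv E]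
    exact steps_app ..

theorem dummyArgs_arrPow (k : ℕ) (α β : STy) : (dummyArgs (arrPow k α β) : ArgList rank _) =
    pushPow k (fun _ => clo (dummy α) dummyEnv) (dummyArgs β) := by
  induction k with
  | zero => rfl
  | succ k ih => simp only [arrPow, dummyArgs, pushPow, ih]

theorem dummyArgs_treeTy (m : ℕ) : ∀ (d : ℕ) (β : STy), (dummyArgs (arrs m d β) : ArgList rank _) =
    pushes d (fun d' _ => clo (dummy (treeTy m d')) dummyEnv) (dummyArgs β)
  | 0, _ => rfl
  | d + 1, β => by simp only [arrs, pushes, dummyArgs_arrPow, dummyArgs_treeTy m d β]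

theorem steps_lamPow (Q : Type) {v : ℕ → ℕ} (hv : v.Injective) (f : ℕ → Closure rank α)
    (Cs : ArgList rank β) : ∀ (k : ℕ) (M : LTerm rank β) (E : Env rank), ∃ E' : Env rank,
      (∀ q : Q, Steps ⟨q, clo (lamPow (α := α) v k M) E, pushPow k f Cs⟩ ⟨q, clo M E', Cs⟩) ∧
      (∀ j < k, E' ⟨α, v j⟩ = f j) ∧ ∀ z, (∀ j < k, z ≠ ⟨α, v j⟩) → E' z = E z
  | 0, _, E => ⟨E, fun _ => .refl, by simp, fun _ _ => rfl⟩
  | k + 1, M, E => by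
    classical
    obtain ⟨E', h1, h2, h3⟩ :=
      steps_lamPow Q hv f Cs k M (Function.update E ⟨α, v k⟩ (f k))
    refine ⟨E', fun q => .trans ?_ (h1 q), fun j hj => ?_, fun z hz => ?_⟩
    · exact steps_lam q ⟨α, v k⟩ (lamPow v k M) E (f k) (pushPow k f Cs)
    · rcases Nat.lt_succ_iff_lt_or_eq.1 hj with hj | rfl
      · exact h2 j hj
      · rw [h3 _ fun i hi => ?_, Function.update_self]
        intro h
        injection h with _ h
        exact hi.ne (hv h).symm
    · rw [h3 z fun j hj => hz j (Nat.lt_succ_of_lt hj),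
        Function.update_of_ne (hz k (Nat.lt_succ_self k))]

/-- Calling an iterated abstraction: the resulting environment holds the arguments under the names of
the abstracted variables and is unchanged elsewhere. -/
theorem steps_lams (Q : Type) {v : ℕ → ℕ → ℕ} (hv : ∀ a b c d, v a b = v c d → a = c ∧ b = d)
    (f : ∀ d', ℕ → Closure rank (treeTy m d')) (Cs : ArgList rank β) :
    ∀ (d : ℕ) (M : LTerm rank β) (E : Env rank), ∃ E' : Env rank,
      (∀ q : Q, Steps ⟨q, clo (lams v d M) E, pushes d f Cs⟩ ⟨q, clo M E', Cs⟩) ∧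
      (∀ d' < d, ∀ j < m, E' ⟨treeTy m d', v d' j⟩ = f d' j) ∧
      ∀ z, (∀ d' < d, ∀ j < m, z ≠ ⟨treeTy m d', v d' j⟩) → E' z = E z
  | 0, _, E => ⟨E, fun _ => .refl, by simp, fun _ _ => rfl⟩
  | d + 1, M, E => by
    obtain ⟨E₁, h1, h2, h3⟩ := steps_lamPow Q (v := v d) (fun i j h => (hv _ _ _ _ h).2)
      (f d) (pushes d f Cs) m (lams v d M) E
    obtain ⟨E₂, k1, k2, k3⟩ := steps_lams Q hv f Cs d M E₁
    refine ⟨E₂, fun q => .trans (h1 q) (k1 q), fun d' hd' j hj => ?_, fun z hz => ?_⟩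
    · rcases Nat.lt_succ_iff_lt_or_eq.1 hd' with hd' | rfl
      · exact k2 d' hd' j hj
      · rw [k3 _ fun d'' hd'' j' hj' h => ?_, h2 j hj]
        injection h with _ h
        exact hd''.ne (hv _ _ _ _ h).1.symm
    · rw [k3 z fun d' hd' => hz d' (Nat.lt_succ_of_lt hd'), h3 z (hz d (Nat.lt_succ_self d))]

/-! ### Free variables -/

theorem fv_appPow {x : LVar} (f : ℕ → LTerm rank α) : ∀ (k : ℕ) (M : LTerm rank (arrPow k α β)),
    x ∈ (appPow k M f).fv ↔ x ∈ M.fv ∨ ∃ j < k, x ∈ (f j).fv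
  | 0, M => ⟨.inl, fun h => h.elim id fun ⟨_, h, _⟩ => absurd h (Nat.not_lt_zero _)⟩
  | k + 1, M => by
    refine (fv_appPow f k _).trans ((or_assoc (a := x ∈ M.fv) (b := x ∈ (f k).fv)).trans ?_)
    refine or_congr_right ?_
    simp only [Nat.lt_succ_iff_lt_or_eq]
    grind

theorem fv_apps {x : LVar} (f : ∀ d', ℕ → LTerm rank (treeTy m d')) :
    ∀ (d : ℕ) (M : LTerm rank (arrs m d β)),
      x ∈ (apps d M f).fv ↔ x ∈ M.fv ∨ ∃ d' < d, ∃ j < m, x ∈ (f d' j).fv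
  | 0, M => ⟨.inl, fun h => h.elim id fun ⟨_, h, _⟩ => absurd h (Nat.not_lt_zero _)⟩
  | d + 1, M => by
    refine (fv_apps f d _).trans ((or_congr_left (fv_appPow (f d) m M)).trans (or_assoc.trans ?_))
    refine or_congr_right ?_
    simp only [Nat.lt_succ_iff_lt_or_eq]
    grind

theorem fv_saturate : ∀ (α : STy) (M : LTerm rank α), (saturate α M).fv = M.fv
  | .base, _ => rfl
  | .arr α β, M => by rw [saturate, fv_saturate β, LTerm.fv, fv_dummy, Set.union_empty]

theorem fv_lamPow {x : LVar} (v : ℕ → ℕ) : ∀ (k : ℕ) (M : LTerm rank β),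
    x ∈ (lamPow (α := α) v k M).fv ↔ x ∈ M.fv ∧ ∀ j < k, x ≠ ⟨α, v j⟩
  | 0, M => ⟨fun h => ⟨h, fun _ h => absurd h (Nat.not_lt_zero _)⟩, And.left⟩
  | k + 1, M => by
    refine (and_congr_left' (fv_lamPow v k M)).trans (and_assoc.trans (and_congr_right' ?_))
    simp only [Nat.lt_succ_iff_lt_or_eq, Set.mem_singleton_iff]
    grind

theorem fv_lams {x : LVar} (v : ℕ → ℕ → ℕ) : ∀ (d : ℕ) (M : LTerm rank β),
    x ∈ (lams (m := m) v d M).fv ↔ x ∈ M.fv ∧ ∀ d' < d, ∀ j < m, x ≠ ⟨treeTy m d', v d' j⟩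
  | 0, M => ⟨fun h => ⟨h, fun _ h => absurd h (Nat.not_lt_zero _)⟩, And.left⟩
  | d + 1, M => by
    refine (fv_lamPow (v d) m _).trans ((and_congr_left' (fv_lams v d M)).trans
      (and_assoc.trans (and_congr_right' ?_)))
    simp only [Nat.lt_succ_iff_lt_or_eq]
    grind

theorem fv_appConst {x : LVar} : ∀ (k : ℕ) (M : LTerm rank (STy.const k))
    (f : Fin k → LTerm rank .base), x ∈ (appConst k M f).fv ↔ x ∈ M.fv ∨ ∃ i, x ∈ (f i).fv
  | 0, M, f => ⟨.inl, fun h => h.elim id fun ⟨i, _⟩ => i.elim0⟩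
  | k + 1, M, f => by
    refine (fv_appConst k _ _).trans
      ((or_assoc (a := x ∈ M.fv) (b := x ∈ (f 0).fv)).trans (or_congr_right ?_))
    exact (Fin.exists_fin_succ (P := fun i => x ∈ (f i).fv)).symm

/-! ### Levels -/

variable {l : ℕ}

theorem level_le_of_levelAtMost {α : STy} {M : LTerm rank α} (h : M.LevelAtMost l) : α.level ≤ l := by
  cases h <;> assumption

theorem levelAtMost_dummy (h : α.level ≤ l) : (dummy α : LTerm rank α).LevelAtMost l :=
  .fix_lam _ h (.var _ h)

theorem levelAtMost_saturate : ∀ (α : STy) (M : LTerm rank α), M.LevelAtMost l →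
    (saturate α M).LevelAtMost l
  | .base, _, h => h
  | .arr α β, M, h => by
    have := level_le_of_levelAtMost h
    simp only [STy.level] at this
    exact levelAtMost_saturate β _ (.app (by omega) h (levelAtMost_dummy (by omega)))

theorem levelAtMost_appPow (f : ℕ → LTerm rank α) : ∀ (k : ℕ) (M : LTerm rank (arrPow k α β)),
    M.LevelAtMost l → (∀ j < k, (f j).LevelAtMost l) → (appPow k M f).LevelAtMost l
  | 0, _, h, _ => h
  | k + 1, M, h, hf => by
    have := level_le_of_levelAtMost h
    simp only [STy.level] at this
    exact levelAtMost_appPow f k _ (.app (by omega) h (hf k (Nat.lt_succ_self k)))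
      fun j hj => hf j (Nat.lt_succ_of_lt hj)

theorem levelAtMost_apps (f : ∀ d', ℕ → LTerm rank (treeTy m d')) :
    ∀ (d : ℕ) (M : LTerm rank (arrs m d β)), M.LevelAtMost l →
      (∀ d' < d, ∀ j < m, (f d' j).LevelAtMost l) → (apps d M f).LevelAtMost l
  | 0, _, h, _ => h
  | d + 1, M, h, hf =>
    levelAtMost_apps f d _ (levelAtMost_appPow _ m M h (hf d (Nat.lt_succ_self d)))
      fun d' hd' => hf d' (Nat.lt_succ_of_lt hd')

theorem levelAtMost_lamPow (v : ℕ → ℕ) : ∀ (k : ℕ) (M : LTerm rank β), α.level + 1 ≤ l →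
    M.LevelAtMost l → (lamPow (α := α) v k M).LevelAtMost l
  | 0, _, _, h => h
  | k + 1, M, hα, h => by
    have h' := levelAtMost_lamPow v k M hα h
    have := level_le_of_levelAtMost h'
    exact .lam _ (by simp only [STy.level]; omega) h'

theorem levelAtMost_lams (v : ℕ → ℕ → ℕ) : ∀ (d : ℕ) (M : LTerm rank β), d ≤ l →
    M.LevelAtMost l → (lams (m := m) v d M).LevelAtMost l
  | 0, _, _, h => h
  | d + 1, M, hd, h => by
    have := level_treeTy_le m d
    exact levelAtMost_lamPow _ m _ (by simp only [treeTy] at this; omega)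
      (levelAtMost_lams v d M (by omega) h)

theorem levelAtMost_appConst : ∀ (k : ℕ) (M : LTerm rank (STy.const k))
    (f : Fin k → LTerm rank .base), M.LevelAtMost l → (∀ i, (f i).LevelAtMost l) →
      (appConst k M f).LevelAtMost l
  | 0, _, _, h, _ => h
  | k + 1, M, f, h, hf => by
    have := level_le_of_levelAtMost h
    simp only [STy.const, STy.level] at this
    exact levelAtMost_appConst k _ _ (.app (by omega) h (hf 0)) fun i => hf i.succ

/-! ### Sub-terms -/

theorem isSubterm_lamPow (v : ℕ → ℕ) {γ : STy} {N : LTerm rank γ} : ∀ (k : ℕ) (M : LTerm rank β),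
    LTerm.IsSubterm N M → LTerm.IsSubterm N (lamPow (α := α) v k M)
  | 0, _, h => h
  | k + 1, M, h => .lam _ (isSubterm_lamPow v k M h)

theorem isSubterm_lams (v : ℕ → ℕ → ℕ) {γ : STy} {N : LTerm rank γ} :
    ∀ (d : ℕ) (M : LTerm rank β),
      LTerm.IsSubterm N M → LTerm.IsSubterm N (lams (m := m) v d M)
  | 0, _, h => h
  | d + 1, M, h => isSubterm_lamPow _ m _ (isSubterm_lams v d M h)

theorem isSubterm_saturate {γ : STy} {N : LTerm rank γ} : ∀ (α : STy) (M : LTerm rank α),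
    LTerm.IsSubterm N M → LTerm.IsSubterm N (saturate α M)
  | .base, _, h => h
  | .arr _ β, _, h => isSubterm_saturate β _ (.app_left h)

theorem isSubterm_appConst_head {γ : STy} {N : LTerm rank γ} : ∀ (k : ℕ)
    (M : LTerm rank (STy.const k)) (f : Fin k → LTerm rank .base),
      LTerm.IsSubterm N M → LTerm.IsSubterm N (appConst k M f)
  | 0, _, _, h => h
  | k + 1, _, _, h => isSubterm_appConst_head k _ _ (.app_left h)

theorem isSubterm_appConst : ∀ (k : ℕ)
    (M : LTerm rank (STy.const k)) (f : Fin k → LTerm rank .base) (i : Fin k),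
      LTerm.IsSubterm (f i) (appConst k M f)
  | 0, _, _, i => i.elim0
  | k + 1, M, f, i => by
    refine Fin.cases ?_ (fun i => ?_) i
    · exact isSubterm_appConst_head k _ _ (.app_right (.refl _))
    · exact isSubterm_appConst k _ (fun i => f i.succ) i

end Spines

/-! ### Matching and substitution of trees -/

section Trees

variable {Sym : Type u} {rank : Sym → ℕ} {V W X : Type}

theorem subst_congr {σ τ : V → RTree rank W} : ∀ (u : RTree rank V),
    (∀ x ∈ u.vars, σ x = τ x) → u.subst σ = u.subst τ
  | .var x, h => h x rfl
  | .node a us, h => by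
    simp only [RTree.subst]
    congr 1
    funext i
    exact subst_congr (us i) fun x hx => h x (Set.mem_iUnion.2 ⟨i, hx⟩)

theorem subst_subst (σ : V → RTree rank W) (τ : W → RTree rank X) : ∀ (u : RTree rank V),
    (u.subst σ).subst τ = u.subst fun x => (σ x).subst τ
  | .var x => rfl
  | .node a us => by
    simp only [RTree.subst]
    congr 1
    funext i
    exact subst_subst σ τ (us i)

theorem emb_injective : Function.Injective (RTree.emb (rank := rank)) := by
  intro s
  induction s with
  | var x => exact x.elim
  | node a ss ih =>
    intro t h
    cases t with
    | var x => exact x.elim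
    | node b ts =>
      simp only [RTree.emb, RTree.subst, RTree.node.injEq] at h
      obtain ⟨rfl, h⟩ := h
      congr 1
      funext i
      exact ih i (congrFun (eq_of_heq h) i)

theorem exists_emb_of_subst_eq_emb {σ : V → RTree rank TreeVar} : ∀ (u : RTree rank V)
    (t : RTree rank Empty), t.emb = u.subst σ → ∀ x ∈ u.vars, ∃ s : RTree rank Empty, σ x = s.emb
  | .var y, t, h, x, hx => ⟨t, by rw [Set.mem_singleton_iff.1 hx, h]; rfl⟩
  | .node a us, .var y, _, _, _ => y.elim
  | .node a us, .node b ts, h, x, hx => by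
    simp only [RTree.emb, RTree.subst, RTree.node.injEq] at h
    obtain ⟨rfl, h⟩ := h
    obtain ⟨i, hi⟩ := Set.mem_iUnion.1 hx
    exact exists_emb_of_subst_eq_emb (us i) (ts i) (congrFun (eq_of_heq h) i) x hi

/-- The order of a tree without variables. -/
def groundOrder (ord : Sym → ℕ) (t : RTree rank Empty) : ℕ := t.emb.order ord

/-- The tree `t` has the shape of the pattern `u`, with a tree of the right order below every variable.
Repeated variables are not compared; for linear patterns this is matching, see
`Matches.exists_subst`. -/
def Matches (ord : Sym → ℕ) : RTree rank TreeVar → RTree rank Empty → Prop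
  | .var x, t => groundOrder ord t = x.ord
  | .node a us, t => ∃ ts, t = .node a ts ∧ ∀ i, Matches ord (us i) (ts i)

theorem matches_subst {ord : Sym → ℕ} {σ : TreeVar → RTree rank Empty} :
    ∀ (u : RTree rank TreeVar), (∀ x ∈ u.vars, groundOrder ord (σ x) = x.ord) →
      Matches ord u (u.subst σ)
  | .var x, h => h x rfl
  | .node _ us, h =>
    ⟨_, rfl, fun i => matches_subst (us i) fun x hx => h x (Set.mem_iUnion.2 ⟨i, hx⟩)⟩

/-- For a linear pattern, local substitutions at the leaves combine to a global one. -/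
theorem Matches.exists_subst {ord : Sym → ℕ} : ∀ (u : RTree rank TreeVar) (t : RTree rank Empty),
    u.Linear → Matches ord u t → ∃ σ : TreeVar → RTree rank Empty,
      (∀ x ∈ u.vars, groundOrder ord (σ x) = x.ord) ∧ t = u.subst σ
  | .var x, t, _, h => ⟨fun _ => t, fun y hy => by rw [Set.mem_singleton_iff.1 hy]; exact h, rfl⟩
  | .node a us, _, hl, ⟨ts, rfl, h⟩ => by
    classical
    choose σ hσ using fun i => Matches.exists_subst (us i) (ts i) (hl.1 i) (h i)
    have key : ∀ x, ∃ s, ∀ i, x ∈ (us i).vars → s = σ i x := by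
      intro x
      by_cases hx : ∃ i, x ∈ (us i).vars
      · obtain ⟨i, hi⟩ := hx
        refine ⟨σ i x, fun j hj => ?_⟩
        by_cases hij : i = j
        · rw [hij]
        · exact absurd hj (Set.disjoint_left.1 (hl.2 i j hij) hi)
      · exact ⟨.node a ts, fun i hi => absurd ⟨i, hi⟩ hx⟩
    choose τ hτ using key
    refine ⟨τ, fun x hx => ?_, ?_⟩
    · obtain ⟨i, hi⟩ := Set.mem_iUnion.1 hx
      rw [hτ x i hi]
      exact (hσ i).1 x hi
    · simp only [RTree.subst]
      congr 1
      funext i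
      rw [(hσ i).2]
      exact subst_congr _ fun x hx => (hτ x i hx).symm

theorem emb_subst (u : RTree rank V) (σ : V → RTree rank Empty) :
    (u.subst σ).emb = u.subst fun x => (σ x).emb := subst_subst _ _ _

/-- The sub-trees of a tree. -/
def subtrees : RTree rank V → Set (RTree rank V)
  | .var x => {.var x}
  | .node a us => insert (.node a us) (⋃ i, subtrees (us i))

theorem self_mem_subtrees (u : RTree rank V) : u ∈ subtrees u := by
  cases u with
  | var x => rfl
  | node a us => exact Set.mem_insert _ _

theorem finite_subtrees : ∀ u : RTree rank V, (subtrees u).Finite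
  | .var _ => Set.finite_singleton _
  | .node _ us => (Set.finite_iUnion fun i => finite_subtrees (us i)).insert _

theorem child_mem_subtrees {a : Sym} {us : Fin (rank a) → RTree rank V} (i : Fin (rank a)) :
    ∀ u : RTree rank V, .node a us ∈ subtrees u → us i ∈ subtrees u
  | .var x, h => by cases h
  | .node b vs, h => by
    rcases h with h | h
    · rw [← h]
      exact .inr (Set.mem_iUnion.2 ⟨i, self_mem_subtrees _⟩)
    · obtain ⟨j, hj⟩ := Set.mem_iUnion.1 h
      exact .inr (Set.mem_iUnion.2 ⟨j, child_mem_subtrees i (vs j) hj⟩)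

variable {n : ℕ} {S : AOTPS.{u, v} n}

theorem groundOrder_pos (t : RTree S.rank Empty) : 1 ≤ groundOrder S.ord t := by
  cases t with
  | var x => exact x.elim
  | node a ts => exact S.one_le_ord a

theorem groundOrder_le (t : RTree S.rank Empty) : groundOrder S.ord t ≤ n := by
  cases t with
  | var x => exact x.elim
  | node a ts => exact S.ord_le a

/-- The steps of an AOTPS, with substitutions by trees without variables. -/
theorem aotps_step_iff {p : S.Loc} {t : RTree S.rank Empty} {C : Set S.Config} :
    S.Step (p, t) C ↔ ∃ ρ ∈ S.rules, ∃ σ : TreeVar → RTree S.rank Empty,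
      p = ρ.src ∧ (∀ x ∈ ρ.lhs.vars, groundOrder S.ord (σ x) = x.ord) ∧
      t = ρ.lhs.subst σ ∧ C = {c | c.1 ∈ ρ.tgt ∧ c.2 = ρ.rhs.subst σ} := by
  classical
  constructor
  · rintro ⟨ρ, hρ, σ, t', hord, hp, hl, hr, rfl⟩
    have key : ∀ x, ∃ s : RTree S.rank Empty, x ∈ ρ.lhs.vars → σ x = s.emb := by
      intro x
      by_cases hx : x ∈ ρ.lhs.vars
      · obtain ⟨s, hs⟩ := exists_emb_of_subst_eq_emb _ _ hl x hx
        exact ⟨s, fun _ => hs⟩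
      · exact ⟨t, fun h => absurd h hx⟩
    choose τ hτ using key
    have ht' : t' = ρ.rhs.subst τ := by
      apply emb_injective
      rw [hr, emb_subst]
      exact subst_congr _ fun x hx => hτ x ((S.wellFormed ρ hρ).2.1 hx)
    refine ⟨ρ, hρ, τ, hp, fun x hx => ?_, ?_, by rw [ht']⟩
    · rw [groundOrder, ← hτ x hx]
      exact hord x
    · apply emb_injective
      rw [emb_subst]
      exact hl.trans (subst_congr _ hτ)
  · rintro ⟨ρ, hρ, σ, rfl, hord, rfl, rfl⟩
    refine ⟨ρ, hρ, fun x => if x ∈ ρ.lhs.vars then (σ x).emb else .var x, ρ.rhs.subst σ,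
      fun x => ?_, rfl, ?_, ?_, rfl⟩
    · dsimp only
      split_ifs with hx
      · exact hord x hx
      · rfl
    · rw [emb_subst]
      exact subst_congr _ fun x hx => (if_pos hx).symm
    · rw [emb_subst]
      exact subst_congr _ fun x hx => (if_pos ((S.wellFormed ρ hρ).2.1 hx)).symm

end Trees

/-! ### Alphabet, states and terms of the machine -/

/-- The letters of the machine: `sel` lists the possible continuations at a node, and `tag i` announces
a node of type `i`. -/
inductive Letter (ι : Type) : Type
  | sel : Letter ι
  | tag (i : ι) : Letter ι

instance {ι : Type} [Finite ι] : Finite (Letter ι) :=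
  Finite.of_surjective (fun o : Option ι => o.elim .sel .tag) fun a => by
    cases a with
    | sel => exact ⟨none, rfl⟩
    | tag i => exact ⟨some i, rfl⟩

section Construction

variable {n : ℕ} (S : AOTPS.{u, v} n)

/-- The depth `n - o` of the order `o ∈ {1, …, n}`. Orders outside this range get a meaningless value. -/
def depth (n : ℕ) [NeZero n] (o : ℕ) : Fin n := Fin.ofNat n (n - o)

theorem depth_lt_depth [NeZero n] {o o' : ℕ} (ho : 1 ≤ o) (h : o < o') (ho' : o' ≤ n) :
    (depth n o' : ℕ) < depth n o := by
  simp only [depth, Fin.ofNat]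
  rw [Nat.mod_eq_of_lt (by omega), Nat.mod_eq_of_lt (by omega)]
  omega

/-- A bound on the ranks. -/
noncomputable def maxRank : ℕ := sSup (Set.range S.rank)

theorem rank_le_maxRank (a : S.Sym) : S.rank a ≤ maxRank S := by
  have := S.finite_Sym
  exact le_csSup (Set.finite_range S.rank).bddAbove ⟨a, rfl⟩

/-- The type of a node: its label and the depths of its children. -/
abbrev NodeType : Type u := Σ a : S.Sym, Fin (S.rank a) → Fin n

/-- The sub-trees of left-hand sides of rules. -/
abbrev Pattern : Type u := {u : RTree S.rank TreeVar // ∃ ρ ∈ S.rules, u ∈ subtrees ρ.lhs}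

/-- The continuations of a computation at a node: go to the child at position `j` if it has depth `d`,
either discarding everything else (`child`) or remembering the children of smaller depth (`deep`);
go to the right-hand side of `ρ`, where `κ` tells at which position the second symbol of the
left-hand side is, if any (`rhs`). The continuation `gen i` is never taken: it provides a sub-term
from which closures for arbitrary trees are made. -/
inductive Branch : Type (max u v)
  | child (d : Fin n) (j : Fin (maxRank S))
  | deep (d : Fin n) (j : Fin (maxRank S))
  | rhs (ρ : S.rules) (κ : Option (Fin (maxRank S)))
  | gen (i : NodeType S)

/-- What the machine does at the root of the current tree: rewrite it in control location `p`, apply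
the rule `ρ` to it as the tree at position `k` of a deep left-hand side, or match it against a
pattern. -/
inductive Task : Type (max u v)
  | main (p : S.Loc)
  | inspect (ρ : S.rules) (k : Fin (maxRank S))
  | check (w : Pattern S)

/-- A task, together with the type of the current node once it is known. -/
abbrev State : Type (max u v) := Task S × Option (NodeType S)

instance : Finite (NodeType S) := by
  have := S.finite_Sym
  infer_instance

instance : Finite S.rules := S.finite_rules

instance : Finite (Pattern S) := by
  have : {u : RTree S.rank TreeVar | ∃ ρ ∈ S.rules, u ∈ subtrees ρ.lhs} =
      ⋃ ρ ∈ S.rules, subtrees ρ.lhs := by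
    ext u
    simp
  show Finite {u : RTree S.rank TreeVar | ∃ ρ ∈ S.rules, u ∈ subtrees ρ.lhs}
  rw [this]
  exact S.finite_rules.biUnion fun ρ _ => finite_subtrees ρ.lhs

instance : Finite (Branch S) := by
  refine Finite.of_surjective
    (α := ((Fin n × Fin (maxRank S)) ⊕ (Fin n × Fin (maxRank S))) ⊕
      ((S.rules × Option (Fin (maxRank S))) ⊕ NodeType S))
    (Sum.elim (Sum.elim (fun x => .child x.1 x.2) fun x => .deep x.1 x.2)
      (Sum.elim (fun x => .rhs x.1 x.2) .gen)) fun b => ?_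
  cases b with
  | child d j => exact ⟨.inl (.inl (d, j)), rfl⟩
  | deep d j => exact ⟨.inl (.inr (d, j)), rfl⟩
  | rhs ρ κ => exact ⟨.inr (.inl (ρ, κ)), rfl⟩
  | gen i => exact ⟨.inr (.inr i), rfl⟩

instance : Finite (Task S) := by
  have := S.finite_Loc
  refine Finite.of_surjective (α := S.Loc ⊕ ((S.rules × Fin (maxRank S)) ⊕ Pattern S))
    (Sum.elim .main (Sum.elim (fun x => .inspect x.1 x.2) .check)) fun b => ?_
  cases b with
  | main p => exact ⟨.inl p, rfl⟩
  | inspect ρ k => exact ⟨.inr (.inl (ρ, k)), rfl⟩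
  | check w => exact ⟨.inr (.inr w), rfl⟩

/-- The letters of the machine; node types are numbered, as letters live in `Type`. -/
abbrev Alphabet : Type := Letter (Fin (Nat.card (NodeType S)))

/-- The ranks of the letters. -/
noncomputable def letterRank : Alphabet S → ℕ
  | .sel => Nat.card (Branch S)
  | .tag _ => 1

/-- The terms of the machine. -/
abbrev Term (α : STy) : Type := LTerm (letterRank S) α

/-- The constant `sel`. -/
noncomputable def selConst : Term S (STy.const (Nat.card (Branch S))) :=
  LTerm.const (rank := letterRank S) Letter.sel

/-- The constant `tag i`. -/
noncomputable def tagConst (i : NodeType S) : Term S (.arr .base .base) :=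
  LTerm.const (rank := letterRank S) (Letter.tag (Finite.equivFin _ i))

/-- The names of the variables for the children of a node. -/
def xName (d j : ℕ) : ℕ := Nat.pair 1 (Nat.pair d j)
/-- The names of the variables for the trees inherited from the parent of a node. -/
def yName (d j : ℕ) : ℕ := Nat.pair 2 (Nat.pair d j)
/-- The names of the variables bound in `nodeTerm`. -/
def zName (d j : ℕ) : ℕ := Nat.pair 3 (Nat.pair d j)

/-- The type of trees at depth `d`. -/
noncomputable abbrev slotTy (d : ℕ) : STy := treeTy (maxRank S) d

/-- The variable for the child at position `j`, if it has depth `d`. -/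
noncomputable abbrev xVar (d j : ℕ) : LVar := ⟨slotTy S d, xName d j⟩
/-- The variable for the tree at position `j` and depth `d` below the parent. -/
noncomputable abbrev yVar (d j : ℕ) : LVar := ⟨slotTy S d, yName d j⟩
/-- The formal parameter of a node term that becomes `yVar S d j`. -/
noncomputable abbrev zVar (d j : ℕ) : LVar := ⟨slotTy S d, zName d j⟩

/-- The type of the universal constructor: it takes the children and the inherited trees. -/
noncomputable abbrev ctorTy : STy := arrs (maxRank S) n (arrs (maxRank S) n .base)

/-- The variable for the universal constructor. -/
noncomputable abbrev ctorVar : LVar := ⟨ctorTy S, Nat.pair 0 0⟩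

variable {S} in
/-- The universal constructor applied to the children `f` and to the inherited trees; a node at depth
`d` inherits trees of smaller depths only. -/
noncomputable def ctorCall (d : ℕ) (f : ∀ d', ℕ → Term S (slotTy S d')) : Term S .base :=
  apps n (apps n (.var (ctorVar S)) f)
    fun d' j => if d' < d then .var (zVar S d' j) else dummy _

variable {S} in
/-- A node of type `i` at depth `d` with children `f`: it expects the inherited trees, announces its
type and calls the universal constructor. -/
noncomputable def nodeTerm (i : NodeType S) (d : ℕ) (f : ∀ d', ℕ → Term S (slotTy S d')) :
    Term S (slotTy S d) :=
  lams zName d (.app (tagConst S i) (ctorCall d f))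

/-- `u` is the child of `t` at position `j`. -/
def ChildAt {Sym : Type u} {rank : Sym → ℕ} {V : Type} (t : RTree rank V) (j : ℕ)
    (u : RTree rank V) : Prop :=
  ∃ (a : Sym) (ts : Fin (rank a) → RTree rank V) (h : j < rank a), t = .node a ts ∧ ts ⟨j, h⟩ = u

variable {S} in
/-- The variable `x` is the child at position `j` of the node at which the right-hand side of `ρ` is
built: the root for `κ = none`, the child of the root at position `k` for `κ = some k`. -/
def XPos (ρ : S.rules) : Option (Fin (maxRank S)) → TreeVar → ℕ → Prop
  | none, x, j => ChildAt ρ.1.lhs j (.var x)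
  | some k, x, j => ∃ u, ChildAt ρ.1.lhs k u ∧ ChildAt u j (.var x)

variable {S} in
open Classical in
/-- The term for a variable in the right-hand side of `ρ`: a child of the current node if possible, and
an inherited tree otherwise. -/
noncomputable def ruleVar (ρ : S.rules) (κ : Option (Fin (maxRank S))) (x : TreeVar) (d : ℕ) :
    Term S (slotTy S d) :=
  if h : ∃ j, XPos ρ κ x j then .var (xVar S d h.choose)
  else if h : ∃ j, ChildAt ρ.1.lhs j (.var x) then .var (yVar S d h.choose)
  else dummy _

variable {S} in
/-- The children of the node term in the continuation `gen i`. -/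
noncomputable def genArgs (i : NodeType S) (d j : ℕ) : Term S (slotTy S d) :=
  if ∃ h : j < S.rank i.1, (i.2 ⟨j, h⟩ : ℕ) = d then .var (xVar S d j) else dummy _

/-! ### Free variables and levels of the auxiliary terms -/

section Scope

variable {S}

/-- The free variables of `M` are among those bound around the body of the universal constructor. -/
def Scoped {α : STy} (M : Term S α) : Prop :=
  ∀ x ∈ M.fv, x = ctorVar S ∨ ∃ d < n, ∃ j < maxRank S, x = xVar S d j ∨ x = yVar S d j

theorem xVar_ne_zVar {d j d' j' : ℕ} : xVar S d j ≠ zVar S d' j' := by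
  intro h
  injection h with _ h
  simp [xName, zName, Nat.pair_eq_pair] at h

theorem yVar_ne_zVar {d j d' j' : ℕ} : yVar S d j ≠ zVar S d' j' := by
  intro h
  injection h with _ h
  simp [yName, zName, Nat.pair_eq_pair] at h

theorem xVar_ne_yVar {d j d' j' : ℕ} : xVar S d j ≠ yVar S d' j' := by
  intro h
  injection h with _ h
  simp [xName, yName, Nat.pair_eq_pair] at h

theorem ctorVar_ne {d j k : ℕ} {α : STy} : ctorVar S ≠ ⟨α, Nat.pair (k + 1) (Nat.pair d j)⟩ := by
  intro h
  injection h with _ h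
  simp [Nat.pair_eq_pair] at h

theorem Scoped.ne_zVar {α : STy} {M : Term S α} (h : Scoped M) {x : LVar} (hx : x ∈ M.fv)
    (d j : ℕ) : x ≠ zVar S d j := by
  rcases h x hx with rfl | ⟨d', _, j', _, rfl | rfl⟩
  · exact ctorVar_ne (k := 2)
  · exact xVar_ne_zVar
  · exact yVar_ne_zVar

theorem scoped_dummy (α : STy) : Scoped (S := S) (dummy α) := by
  intro x hx
  rw [fv_dummy] at hx
  exact hx.elim

theorem scoped_xVar {d j : ℕ} (hd : d < n) (hj : j < maxRank S) :
    Scoped (S := S) (.var (xVar S d j)) := by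
  intro x hx
  exact .inr ⟨d, hd, j, hj, .inl hx⟩

theorem scoped_yVar {d j : ℕ} (hd : d < n) (hj : j < maxRank S) :
    Scoped (S := S) (.var (yVar S d j)) := by
  intro x hx
  exact .inr ⟨d, hd, j, hj, .inr hx⟩

theorem scoped_saturate {α : STy} {M : Term S α} (h : Scoped M) : Scoped (saturate α M) := by
  unfold Scoped
  rw [fv_saturate]
  exact h

theorem fv_ctorCall {d : ℕ} {f : ∀ d', ℕ → Term S (slotTy S d')} {x : LVar}
    (hx : x ∈ (ctorCall d f).fv) : x = ctorVar S ∨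
      (∃ d' < n, ∃ j < maxRank S, x ∈ (f d' j).fv) ∨
      ∃ d' < d, ∃ j < maxRank S, x = zVar S d' j := by
  rw [ctorCall, fv_apps, fv_apps] at hx
  rcases hx with (hx | hx) | ⟨d', hd', j, hj, hx⟩
  · exact .inl hx
  · exact .inr (.inl hx)
  · split_ifs at hx with h
    · exact .inr (.inr ⟨d', h, j, hj, hx⟩)
    · rw [fv_dummy] at hx
      exact hx.elim

/-- A node term binds all the formal parameters that it uses, so trees may be nested without capture. -/
theorem fv_nodeTerm {i : NodeType S} {d : ℕ} {f : ∀ d', ℕ → Term S (slotTy S d')} {x : LVar}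
    (hx : x ∈ (nodeTerm i d f).fv) : x = ctorVar S ∨
      ∃ d' < n, ∃ j < maxRank S, x ∈ (f d' j).fv := by
  rw [nodeTerm, fv_lams] at hx
  obtain ⟨hx, hz⟩ := hx
  rcases hx with hx | hx
  · exact absurd hx (Set.notMem_empty x)
  · rcases fv_ctorCall hx with h | h | ⟨d', hd', j, hj, h⟩
    · exact .inl h
    · exact .inr h
    · exact absurd h (hz d' hd' j hj)

theorem scoped_nodeTerm {i : NodeType S} {d : ℕ} {f : ∀ d', ℕ → Term S (slotTy S d')}
    (hf : ∀ d' < n, ∀ j < maxRank S, Scoped (f d' j)) : Scoped (nodeTerm i d f) := by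
  intro x hx
  rcases fv_nodeTerm hx with h | ⟨d', hd', j, hj, h⟩
  · exact .inl h
  · exact hf d' hd' j hj x h

theorem ChildAt.lt_maxRank {t u : RTree S.rank TreeVar} {j : ℕ} (h : ChildAt t j u) :
    j < maxRank S := by
  obtain ⟨a, _, h, _⟩ := h
  exact h.trans_le (rank_le_maxRank S a)

theorem XPos.lt_maxRank {ρ : S.rules} {κ : Option (Fin (maxRank S))} {x : TreeVar} {j : ℕ}
    (h : XPos ρ κ x j) : j < maxRank S := by
  cases κ with
  | none => exact ChildAt.lt_maxRank h
  | some k => exact h.elim fun _ h => h.2.lt_maxRank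

theorem scoped_ruleVar (ρ : S.rules) (κ : Option (Fin (maxRank S))) (x : TreeVar) (d : ℕ)
    (hd : d < n) : Scoped (ruleVar ρ κ x d) := by
  unfold ruleVar
  split_ifs with h1 h2
  · exact scoped_xVar hd h1.choose_spec.lt_maxRank
  · exact scoped_yVar hd h2.choose_spec.lt_maxRank
  · exact scoped_dummy _

theorem scoped_genArgs (i : NodeType S) (d j : ℕ) (hd : d < n) : Scoped (genArgs i d j) := by
  unfold genArgs
  split_ifs with h
  · exact scoped_xVar hd (h.1.trans_le (rank_le_maxRank S _))
  · exact scoped_dummy _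

theorem levelAtMost_slotVar {d : ℕ} (hd : d < n) (k : ℕ) :
    LTerm.LevelAtMost (rank := letterRank S) n (.var ⟨slotTy S d, k⟩) :=
  .var _ ((level_treeTy_le _ d).trans hd.le)

theorem levelAtMost_slotDummy {d : ℕ} (hd : d < n) :
    LTerm.LevelAtMost n (dummy (slotTy S d) : Term S _) :=
  levelAtMost_dummy ((level_treeTy_le _ d).trans hd.le)

theorem level_ctorTy_le : (ctorTy S).level ≤ n := by
  have h1 := level_arrs_le (maxRank S) n (arrs (maxRank S) n .base)
  have h2 := level_arrs_le (maxRank S) n .base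
  simp only [STy.level] at h2
  exact h1.trans (max_le le_rfl (h2.trans (by simp)))

end Scope

variable [NeZero n]

variable {S} in
/-- The term for a tree `u` with variables at depth `d`, where `w x d` is the term for the variable
`x`. A child is placed at all depths; only the one at its own depth is ever used. -/
noncomputable def treeTerm (w : TreeVar → ∀ d, Term S (slotTy S d)) :
    RTree S.rank TreeVar → ∀ d, Term S (slotTy S d)
  | .var x, d => w x d
  | .node a us, d => nodeTerm ⟨a, fun j => depth n ((us j).order S.ord)⟩ d fun d' j =>
      if h : j < S.rank a then treeTerm w (us ⟨j, h⟩) d' else dummy _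

variable {S} in
/-- The term for a continuation. -/
noncomputable def branchTerm : Branch S → Term S .base
  | .child d j => saturate _ (.var (xVar S d j))
  | .deep d j => apps (d : ℕ) (.var (xVar S d j)) fun d' j' => .var (xVar S d' j')
  | .rhs ρ κ => saturate _ (treeTerm (ruleVar ρ κ) ρ.1.rhs (depth n (ρ.1.rhs.order S.ord)))
  | .gen i => saturate _ (nodeTerm i (depth n (S.ord i.1)) (genArgs i))

/-- The body of the universal constructor: the list of all continuations. -/
noncomputable def body : Term S .base :=
  appConst _ (selConst S) fun b => branchTerm ((Finite.equivFin (Branch S)).symm b)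

/-- The universal constructor as an operator on itself. -/
noncomputable def ctorAbs : Term S (.arr (ctorTy S) (ctorTy S)) :=
  .lam (ctorVar S) (lams xName n (lams yName n (body S)))

/-- The universal constructor `Y (λ G x y. sel B₁ ⋯ B_N)`. -/
noncomputable def ctorTerm : Term S (ctorTy S) := .fix (ctorAbs S)

/-- The start term. Only its sub-terms matter, as `enc` need not map to reachable configurations. -/
noncomputable def startTerm : Term S .base := saturate _ (ctorTerm S)

/-! ### Free variables of the start term -/

variable {S}

theorem scoped_treeTerm {w : TreeVar → ∀ d, Term S (slotTy S d)}
    (hw : ∀ x, ∀ d < n, Scoped (w x d)) : ∀ (u : RTree S.rank TreeVar) (d : ℕ), d < n →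
      Scoped (treeTerm w u d)
  | .var x, d, hd => hw x d hd
  | .node a us, d, hd => by
    rw [treeTerm]
    refine scoped_nodeTerm fun d' hd' j _ => ?_
    split_ifs with h
    · exact scoped_treeTerm hw (us ⟨j, h⟩) d' hd'
    · exact scoped_dummy _

theorem scoped_branchTerm (b : Branch S) : Scoped (branchTerm b) := by
  cases b with
  | child d j => exact scoped_saturate (scoped_xVar d.2 j.2)
  | deep d j =>
    intro x hx
    rw [branchTerm, fv_apps] at hx
    rcases hx with hx | ⟨d', hd', j', hj', hx⟩
    · exact scoped_xVar d.2 j.2 x hx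
    · exact scoped_xVar (hd'.trans d.2) hj' x hx
  | rhs ρ κ =>
    exact scoped_saturate (scoped_treeTerm (scoped_ruleVar ρ κ) _ _ (depth n _).2)
  | gen i => exact scoped_saturate (scoped_nodeTerm fun d' hd' j _ => scoped_genArgs i d' j hd')

theorem scoped_body : Scoped (body S) := by
  intro x hx
  rw [body, fv_appConst] at hx
  rcases hx with hx | ⟨b, hx⟩
  · exact absurd hx (Set.notMem_empty x)
  · exact scoped_branchTerm _ x hx

theorem fv_ctorTerm : (ctorTerm S).fv = ∅ := by
  rw [Set.eq_empty_iff_forall_notMem]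
  rintro x ⟨hx, hc⟩
  rw [fv_lams, fv_lams] at hx
  obtain ⟨⟨hx, hy⟩, hx'⟩ := hx
  rcases scoped_body x hx with h | ⟨d, hd, j, hj, h | h⟩
  · exact hc h
  · exact hx' d hd j hj h
  · exact hy d hd j hj h

theorem fv_startTerm : (startTerm S).fv = ∅ := (fv_saturate _ _).trans fv_ctorTerm

/-! ### Levels of the sub-terms of the start term -/

theorem one_le_of_neZero : 1 ≤ n := Nat.one_le_iff_ne_zero.2 (NeZero.ne n)

theorem levelAtMost_nodeTerm {i : NodeType S} {d : ℕ} {f : ∀ d', ℕ → Term S (slotTy S d')}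
    (hd : d ≤ n) (hf : ∀ d' < n, ∀ j < maxRank S, (f d' j).LevelAtMost n) :
    (nodeTerm i d f).LevelAtMost n := by
  refine levelAtMost_lams _ _ _ hd (.app (Nat.zero_le _)
    (LTerm.LevelAtMost.const (rank := letterRank S) (Letter.tag _) ?_) ?_)
  · exact (level_const_le _).trans one_le_of_neZero
  · refine levelAtMost_apps _ _ _ (levelAtMost_apps _ _ _ (.var _ level_ctorTy_le) hf) ?_
    intro d' hd' j _
    split_ifs
    · exact levelAtMost_slotVar hd' _
    · exact levelAtMost_slotDummy hd'

theorem levelAtMost_treeTerm {w : TreeVar → ∀ d, Term S (slotTy S d)}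
    (hw : ∀ x, ∀ d < n, (w x d).LevelAtMost n) : ∀ (u : RTree S.rank TreeVar) (d : ℕ), d < n →
      (treeTerm w u d).LevelAtMost n
  | .var x, d, hd => hw x d hd
  | .node a us, d, hd => by
    rw [treeTerm]
    refine levelAtMost_nodeTerm hd.le fun d' hd' j _ => ?_
    split_ifs with h
    · exact levelAtMost_treeTerm hw (us ⟨j, h⟩) d' hd'
    · exact levelAtMost_slotDummy hd'

theorem levelAtMost_branchTerm (b : Branch S) : (branchTerm b).LevelAtMost n := by
  cases b with
  | child d j => exact levelAtMost_saturate _ _ (levelAtMost_slotVar d.2 _)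
  | deep d j =>
    exact levelAtMost_apps _ _ _ (levelAtMost_slotVar d.2 _)
      fun d' hd' j' _ => levelAtMost_slotVar (hd'.trans d.2) _
  | rhs ρ κ =>
    refine levelAtMost_saturate _ _ (levelAtMost_treeTerm (fun x d hd => ?_) _ _ (depth n _).2)
    unfold ruleVar
    split_ifs
    · exact levelAtMost_slotVar hd _
    · exact levelAtMost_slotVar hd _
    · exact levelAtMost_slotDummy hd
  | gen i =>
    refine levelAtMost_saturate _ _ (levelAtMost_nodeTerm (depth n _).2.le fun d hd j _ => ?_)
    unfold genArgs
    split_ifs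
    · exact levelAtMost_slotVar hd _
    · exact levelAtMost_slotDummy hd

theorem levelAtMost_startTerm : (startTerm S).LevelAtMost n := by
  refine levelAtMost_saturate _ _ (.fix_lam (ctorVar S) level_ctorTy_le ?_)
  refine levelAtMost_lams _ _ _ le_rfl (levelAtMost_lams _ _ _ le_rfl ?_)
  exact levelAtMost_appConst _ _ _
    (LTerm.LevelAtMost.const (rank := letterRank S) Letter.sel
      ((level_const_le _).trans one_le_of_neZero))
    fun b => levelAtMost_branchTerm _

/-! ### Sub-terms of the start term -/

theorem isSubterm_ctorTerm : LTerm.IsSubterm (ctorTerm S) (startTerm S) :=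
  isSubterm_saturate _ _ (.refl _)

theorem isSubterm_branchTerm (b : Branch S) : LTerm.IsSubterm (branchTerm b) (startTerm S) := by
  refine isSubterm_saturate _ _ (.fix (.lam _ (isSubterm_lams _ _ _ (isSubterm_lams _ _ _ ?_))))
  have := isSubterm_appConst _ (selConst S)
    (fun b => branchTerm ((Finite.equivFin (Branch S)).symm b)) (Finite.equivFin _ b)
  rwa [Equiv.symm_apply_apply] at this

theorem isSubterm_gen_nodeTerm (i : NodeType S) :
    LTerm.IsSubterm (nodeTerm i (depth n (S.ord i.1)) (genArgs i)) (startTerm S) :=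
  isSubterm_trans (isSubterm_saturate _ _ (.refl _)) (isSubterm_branchTerm (.gen i))

/-! ### The transitions and the machine -/

variable (S) in
/-- The states of the machine, numbered as they have to live in `Type`. -/
abbrev Code : Type := Fin (Nat.card (State S))

/-- The numbering of the states. -/
noncomputable def code : State S ≃ Code S := Finite.equivFin _

/-- The states that match the children of a node of type `i` against the children of the pattern `u`. -/
def Checks (u : RTree S.rank TreeVar) (i : NodeType S) (b : Branch S) : Set (State S) :=
  {s | ∃ (us : Fin (S.rank i.1) → RTree S.rank TreeVar) (j : Fin (S.rank i.1)) (w : Pattern S),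
    u = .node i.1 us ∧ w.1 = us j ∧ s = (.check w, none) ∧
    b = .child (i.2 j) (j.castLE (rank_le_maxRank S i.1))}

/-- The states that continue with the right-hand side of `ρ` in the target locations. -/
def Launch (ρ : S.rules) (κ : Option (Fin (maxRank S))) (b : Branch S) : Set (State S) :=
  {s | b = .rhs ρ κ ∧ ∃ q ∈ ρ.1.tgt, s = (.main q, none)}

/-- Apart from matching, a rule `ρ` is applied at the root by building the right-hand side there in the
shallow case, and by going to the child at position `k` in the deep case. -/
def Action (ρ : S.rules) (i : NodeType S) : Option (Fin (maxRank S)) → Branch S → Set (State S)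
  | none, b => Launch ρ none b
  | some k, b => {s | ∃ h : (k : ℕ) < S.rank i.1, b = .deep (i.2 ⟨k, h⟩) k ∧
      s = (.inspect ρ k, none)}

/-- The right-hand side of `ρ` can be built as described by `κ`: each of its variables is a child of the
current node, or it is inherited, having order larger than the label `b` of the current node. -/
def Applicable (ρ : S.rules) : Option (Fin (maxRank S)) → Prop
  | none => ∀ x ∈ ρ.1.rhs.vars, ∃ j, XPos ρ none x j
  | some k => ∃ b vs, ChildAt ρ.1.lhs k (.node b vs) ∧ ∀ x ∈ ρ.1.rhs.vars,
      (∃ j, XPos ρ (some k) x j) ∨ (∃ j, ChildAt ρ.1.lhs j (.var x)) ∧ S.ord b < x.ord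

/-- The root of the pattern `u` has label and child depths as in `i`. -/
def HasType (u : RTree S.rank TreeVar) (i : NodeType S) : Prop :=
  ∃ ts, u = .node i.1 ts ∧ ∀ j, i.2 j = depth n ((ts j).order S.ord)

/-- The variables of `ρ` have orders in the range where `depth` is meaningful. -/
def OrdersBounded (ρ : S.rules) : Prop := ∀ x ∈ ρ.1.lhs.vars, 1 ≤ x.ord ∧ x.ord ≤ n

/-- The transitions at `sel`, for the task and the type of the current node: a map from continuations to
sets of states. -/
inductive Trans : Task S → NodeType S → (Branch S → Set (State S)) → Prop
  | check (w : Pattern S) (i : NodeType S) :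
      (∃ x, w.1 = .var x ∧ S.ord i.1 = x.ord) ∨ (∃ us, w.1 = .node i.1 us) →
      Trans (.check w) i (Checks w.1 i)
  | main (ρ : S.rules) (κ : Option (Fin (maxRank S))) (i : NodeType S) :
      HasType ρ.1.lhs i → OrdersBounded ρ → Applicable ρ κ →
      Trans (.main ρ.1.src) i fun b => Checks ρ.1.lhs i b ∪ Action ρ i κ b
  | inspect (ρ : S.rules) (k : Fin (maxRank S)) (i : NodeType S) (u : RTree S.rank TreeVar) :
      ChildAt ρ.1.lhs k u → HasType u i → OrdersBounded ρ → Applicable ρ (some k) →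
      Trans (.inspect ρ k) i (Launch ρ (some k))

variable (S) in
/-- The transitions of the machine: at `tag i` the type of the node is stored in the state, and at `sel`
the continuations are chosen according to `Trans`. -/
inductive Delta : Code S × (Σ a : Alphabet S, Fin (letterRank S a) → Set (Code S)) → Prop
  | tag (τ : Task S) (i : NodeType S) :
      Delta (code (τ, none), ⟨.tag (Finite.equivFin _ i), fun _ => {code (τ, some i)}⟩)
  | sel {τ : Task S} {i : NodeType S} {P : Branch S → Set (State S)} : Trans τ i P →
      Delta (code (τ, some i), ⟨.sel, fun b => code '' P ((Finite.equivFin (Branch S)).symm b)⟩)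

variable (S) in
/-- The machine that simulates `S`. -/
noncomputable def machine : KrivineMachine n where
  Γ := Alphabet S
  rank := letterRank S
  Q := Code S
  Δ := {δ | Delta S δ}
  K₀ := startTerm S
  finite_Γ := inferInstance
  finite_Q := inferInstance
  closed := fv_startTerm
  level_le := levelAtMost_startTerm

end Construction

/-! ### Representation of trees by closures -/

section Representation

variable {n : ℕ} {S : AOTPS.{u, v} n}

variable (S) in
/-- The configurations of the machine, without the condition on skeletons. -/
abbrev Conf : Type := KConfig (letterRank S) (Code S)

variable (S) in
/-- The closures of the machine. -/
abbrev Clo (α : STy) : Type := Closure (letterRank S) α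

/-- The configuration at which a node announces its type `i`, with continuation `N`. -/
noncomputable def tagConf (q : Code S) (i : NodeType S) (N : Clo S .base) : Conf S :=
  ⟨q, clo (tagConst S i) dummyEnv, .cons N .nil⟩

/-- The letter of a constant. -/
def letterOf {Γ : Type} {rank : Γ → ℕ} {α : STy} : LTerm rank α → Option Γ
  | .const a => some a
  | _ => none

theorem tagConf_injective {q q' : Code S} {i i' : NodeType S} {N N' : Clo S .base}
    (h : tagConf q i N = tagConf q' i' N') : q = q' ∧ i = i' ∧ N = N' := by
  unfold tagConf at h
  injection h with h1 _ h2 h3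
  refine ⟨h1, ?_, ?_⟩
  · unfold clo at h2
    injection h2 with _ h2
    have := congrArg letterOf h2
    simpa [letterOf, tagConst] using this
  · injection h3

variable [NeZero n]

/-- The depth of a tree without variables. -/
def groundDepth (t : RTree S.rank Empty) : Fin n := depth n (groundOrder S.ord t)

/-- The type of the root. -/
def nodeType : RTree S.rank Empty → NodeType S
  | .var x => x.elim
  | .node a ts => ⟨a, fun j => groundDepth (ts j)⟩

/-- The closure of the universal constructor. -/
noncomputable def ctorClo : Clo S (ctorTy S) := clo (ctorTerm S) dummyEnv

/-- The configuration at which a continuation is selected in the environment `E`. -/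
noncomputable def selConf (q : Code S) (E : Env (letterRank S)) : Conf S :=
  ⟨q, clo (selConst S) E,
    pushConst _ fun b => clo (branchTerm ((Finite.equivFin (Branch S)).symm b)) E⟩

/-- `N` reduces silently to the choice of a continuation in the environment `E`. -/
def Opens (N : Clo S .base) (E : Env (letterRank S)) : Prop :=
  ∀ q : Code S, Steps ⟨q, N, .nil⟩ (selConf q E)

/-- `C` reduces silently to `C'` on all arguments. -/
def Forwards {α : STy} (C C' : Clo S α) : Prop :=
  ∀ (q : Code S) (Cs : ArgList (letterRank S) α), Steps ⟨q, C, Cs⟩ ⟨q, C', Cs⟩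

/-- On inherited trees `Cs`, the closure `C` announces the node type `i` and then opens to an environment
that satisfies `P` and in which the inherited variables stand for `Cs`. -/
def BuildsWith (i : NodeType S) (P : Env (letterRank S) → Prop) (d : ℕ) (C : Clo S (slotTy S d)) :
    Prop :=
  ∀ Cs : (∀ d', ℕ → Clo S (slotTy S d')), ∃ N E,
    (∀ q : Code S, Steps ⟨q, C, pushes d Cs .nil⟩ (tagConf q i N)) ∧ Opens N E ∧
    (∀ d' < d, ∀ j < maxRank S, Forwards (E (yVar S d' j)) (Cs d' j)) ∧ P E

/-- The environment `E` holds the children of the root of the tree, each one under the variable for its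
position and depth. -/
def Holds : RTree S.rank Empty → Env (letterRank S) → Prop
  | .var x, _ => x.elim
  | .node a ts, E => E (ctorVar S) = ctorClo ∧ ∀ j : Fin (S.rank a),
      BuildsWith (nodeType (ts j)) (fun E' => Holds (ts j) E') (groundDepth (ts j))
        (E (xVar S (groundDepth (ts j)) j))

/-- The closure `C` at depth `d` behaves like the tree `t`. This is a condition on the reductions of `C`
and not on its syntax, since the same tree is built by closures over different skeletons. -/
def Builds (d : ℕ) (C : Clo S (slotTy S d)) (t : RTree S.rank Empty) : Prop :=
  BuildsWith (nodeType t) (Holds t) d C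

theorem Forwards.builds {d : ℕ} {C C' : Clo S (slotTy S d)} {t : RTree S.rank Empty}
    (h : Forwards C C') (h' : Builds d C' t) : Builds d C t := by
  intro Cs
  obtain ⟨N, E, h1, h2⟩ := h' Cs
  exact ⟨N, E, fun q => (h q _).trans (h1 q), h2⟩

/-- The machine configuration `k` represents `(p, t)`: the root of `t` is about to announce its type, in
the state for rewriting in control location `p`. -/
def Represents (k : Conf S) (c : S.Config) : Prop :=
  ∃ N E, k = tagConf (code (.main c.1, none)) (nodeType c.2) N ∧ Opens N E ∧ Holds c.2 E

/-! ### A machine configuration represents at most one configuration -/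

/-- The environment can be read off the arguments of `sel`, as each variable for a child occurs in some
continuation. -/
theorem eq_of_selConf_eq {q q' : Code S} {E E' : Env (letterRank S)}
    (h : selConf q E = selConf q' E') (d : Fin n) (j : Fin (maxRank S)) :
    E (xVar S d j) = E' (xVar S d j) := by
  unfold selConf at h
  injection h with _ _ _ h
  have h := congrArg (fun Cs => ArgList.get _ Cs (Finite.equivFin _ (Branch.child d j))) h
  simp only [get_pushConst, Equiv.symm_apply_apply] at h
  refine eq_of_clo_eq h _ ?_
  rw [branchTerm, fv_saturate]
  rfl

theorem Opens.unique {N : Clo S .base} {E E' : Env (letterRank S)} (h : Opens N E)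
    (h' : Opens N E') (q : Code S) : selConf q E = selConf q E' :=
  (h q).unique (h' q) rfl rfl

/-- Silent reduction is deterministic, so an environment holds the children of only one tree. -/
theorem holds_unique (q : Code S) : ∀ (t t' : RTree S.rank Empty) (E E' : Env (letterRank S)),
    nodeType t = nodeType t' → selConf q E = selConf q E' → Holds t E → Holds t' E' → t = t'
  | .var x, _, _, _, _, _, _, _ => x.elim
  | _, .var x, _, _, _, _, _, _ => x.elim
  | .node a ts, .node a' ts', E, E', ht, hE, h, h' => by
    simp only [nodeType, Sigma.mk.injEq] at ht
    obtain ⟨rfl, ht⟩ := ht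
    have ht := eq_of_heq ht
    congr 1
    funext j
    have hd : groundDepth (ts j) = groundDepth (ts' j) := congrFun ht j
    have h1 := h.2 j (fun _ _ => clo (dummy _) dummyEnv)
    have h2 := h'.2 j
    have hx := eq_of_selConf_eq hE (groundDepth (ts j)) (j.castLE (rank_le_maxRank S a))
    rw [← hd] at h2
    replace h2 := h2 (fun _ _ => clo (dummy _) dummyEnv)
    obtain ⟨N, E₁, k1, k2, _, k3⟩ := h1
    obtain ⟨N', E₁', l1, l2, _, l3⟩ := h2
    have hx : E (xVar S (groundDepth (ts j)) j) = E' (xVar S (groundDepth (ts j)) j) := hx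
    rw [hx] at k1
    obtain ⟨_, hi, rfl⟩ := tagConf_injective ((k1 q).unique (l1 q) rfl rfl)
    exact holds_unique q (ts j) (ts' j) E₁ E₁' hi (k2.unique l2 q) k3 l3

theorem Represents.unique {k : Conf S} {c c' : S.Config} (h : Represents k c)
    (h' : Represents k c') : c = c' := by
  obtain ⟨N, E, rfl, h1, h2⟩ := h
  obtain ⟨N', E', h, h1', h2'⟩ := h'
  obtain ⟨hq, hi, rfl⟩ := tagConf_injective h
  have hq := code.injective hq
  simp only [Prod.mk.injEq, Task.main.injEq, and_true] at hq
  exact Prod.ext hq (holds_unique (code (.main c.1, none)) _ _ E E' hi (h1.unique h1' _) h2 h2')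

/-! ### Terms that build trees -/

theorem pair_name_inj {k a b c d : ℕ} (h : Nat.pair k (Nat.pair a b) = Nat.pair k (Nat.pair c d)) :
    a = c ∧ b = d := by
  simpa [Nat.pair_eq_pair] using h

open Classical in
/-- A node term announces its type, and the call of the universal constructor opens to an environment in
which the variables `xName` are bound to the children and `yName` to the inherited trees. -/
theorem builds_nodeTerm {E : Env (letterRank S)} (hE : E (ctorVar S) = ctorClo) {a : S.Sym}
    {ts : Fin (S.rank a) → RTree S.rank Empty} {d : ℕ} (hd : d ≤ n)
    {f : ∀ d', ℕ → Term S (slotTy S d')} (hf : ∀ d' < n, ∀ j < maxRank S, Scoped (f d' j))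
    (hb : ∀ j : Fin (S.rank a),
      Builds (groundDepth (ts j)) (clo (f (groundDepth (ts j)) j) E) (ts j)) :
    Builds d (clo (nodeTerm (nodeType (.node a ts)) d f) E) (.node a ts) := by
  intro Cs
  set i := nodeType (.node a ts : RTree S.rank Empty)
  obtain ⟨E₁, s1, hz, hE₁⟩ := steps_lams (Code S) (v := zName) (fun _ _ _ _ => pair_name_inj)
    Cs .nil d (.app (tagConst S i) (ctorCall d f)) E
  set g : ∀ d', ℕ → Term S (slotTy S d') :=
    fun d' j => if d' < d then .var (zVar S d' j) else dummy _ with hg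
  set X : ∀ d', ℕ → Clo S (slotTy S d') := fun d' j => clo (f d' j) E₁ with hX
  set Y : ∀ d', ℕ → Clo S (slotTy S d') := fun d' j => clo (g d' j) E₁ with hY
  have hG : E₁ (ctorVar S) = ctorClo := by
    rw [hE₁ _ fun _ _ _ _ => ctorVar_ne (k := 2), hE]
  set E₂ : Env (letterRank S) := Function.update dummyEnv (ctorVar S) ctorClo with hE₂
  obtain ⟨E₃, s3, hx, hE₃⟩ := steps_lams (Code S) (v := xName) (fun _ _ _ _ => pair_name_inj)
    X (pushes n Y .nil) n (lams yName n (body S)) E₂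
  obtain ⟨E₄, s4, hy, hE₄⟩ := steps_lams (Code S) (v := yName) (fun _ _ _ _ => pair_name_inj)
    Y .nil n (body S) E₃
  -- `E₁` is the environment after the inherited trees are bound, `E₂` to `E₄` those after the
  -- constructor itself, the children `X` and the inherited trees `Y` are bound.
  refine ⟨clo (ctorCall d f) E₁, E₄, fun q => ?_, fun q => ?_, fun d' hd' j hj => ?_, ?_, ?_⟩
  · refine (s1 q).trans ?_
    have := steps_app q (tagConst S i) (ctorCall d f) E₁ .nil
    rwa [show clo (tagConst S i) E₁ = clo (tagConst S i) dummyEnv from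
      clo_congr fun x hx => absurd hx (Set.notMem_empty x)] at this
  · refine (steps_apps q E₁ g .nil n _).trans ?_
    refine (steps_apps q E₁ f (pushes n Y .nil) n _).trans ?_
    refine (steps_var q _ E₁ _).trans ?_
    rw [hG]
    refine (steps_fix q (ctorAbs S) dummyEnv _).trans ?_
    refine (steps_lam q (ctorVar S) _ dummyEnv ctorClo _).trans ?_
    refine (s3 q).trans ((s4 q).trans ?_)
    exact steps_appConst q E₄ _ _ _
  · intro q As
    show Steps ⟨q, E₄ ⟨treeTy (maxRank S) d', yName d' j⟩, As⟩ _
    rw [hy d' (hd'.trans_le hd) j hj, hY, hg]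
    simp only [if_pos hd']
    have := steps_var q (zVar S d' j) E₁ As
    rwa [show E₁ (zVar S d' j) = Cs d' j from hz d' hd' j hj] at this
  · rw [hE₄ _ fun _ _ _ _ => ctorVar_ne (k := 1), hE₃ _ fun _ _ _ _ => ctorVar_ne (k := 0), hE₂,
      Function.update_self]
  · intro j
    have hj : (j : ℕ) < maxRank S := j.2.trans_le (rank_le_maxRank S a)
    have hd := (groundDepth (ts j)).2
    rw [hE₄ _ fun _ _ _ _ => xVar_ne_yVar]
    rw [show E₃ (xVar S (groundDepth (ts j)) j) = _ from hx _ hd j hj, hX]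
    have := hb j
    rwa [show clo (f (groundDepth (ts j)) j) E = clo (f (groundDepth (ts j)) j) E₁ from
      clo_congr fun x hx => (hE₁ x fun d' _ j' _ => (hf _ hd j hj).ne_zVar hx d' j').symm] at this

/-- A substitution that respects depths of variables respects depths of trees. -/
theorem groundDepth_subst {σ : TreeVar → RTree S.rank Empty} : ∀ (u : RTree S.rank TreeVar),
    (∀ x ∈ u.vars, groundDepth (σ x) = depth n x.ord) →
    groundDepth (u.subst σ) = depth n (u.order S.ord)
  | .var x, h => h x rfl
  | .node _ _, _ => rfl

theorem builds_treeTerm {E : Env (letterRank S)} (hE : E (ctorVar S) = ctorClo)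
    {w : TreeVar → ∀ d, Term S (slotTy S d)} (hw : ∀ x, ∀ d < n, Scoped (w x d))
    {σ : TreeVar → RTree S.rank Empty} : ∀ (u : RTree S.rank TreeVar),
      (∀ x ∈ u.vars, groundDepth (σ x) = depth n x.ord ∧
        Builds (depth n x.ord) (clo (w x (depth n x.ord)) E) (σ x)) →
      Builds (depth n (u.order S.ord)) (clo (treeTerm w u (depth n (u.order S.ord))) E) (u.subst σ)
  | .var x, h => (h x rfl).2
  | .node a us, h => by
    have hsub : ∀ j x, x ∈ (us j).vars → x ∈ (RTree.node a us).vars :=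
      fun j x hx => Set.mem_iUnion.2 ⟨j, hx⟩
    have hd : ∀ j, groundDepth ((us j).subst σ) = depth n ((us j).order S.ord) :=
      fun j => groundDepth_subst (us j) fun x hx => (h x (hsub j x hx)).1
    have key : (⟨a, fun j => depth n ((us j).order S.ord)⟩ : NodeType S) =
        nodeType ((RTree.node a us).subst σ) := by
      simp only [RTree.subst, nodeType, hd]
    rw [treeTerm, key]
    refine builds_nodeTerm hE (depth n _).2.le (fun d' hd' j _ => ?_) fun j => ?_
    · split_ifs with hj
      · exact scoped_treeTerm hw _ _ hd'
      · exact scoped_dummy _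
    · rw [dif_pos j.2, hd j]
      exact builds_treeTerm hE hw (us j) fun x hx => h x (hsub j x hx)

theorem builds_saturate {E : Env (letterRank S)} {d : ℕ} {M : Term S (slotTy S d)}
    {t : RTree S.rank Empty} (h : Builds d (clo M E) t) :
    Builds (S := S) 0 (clo (saturate _ M) E) t := by
  intro Cs
  obtain ⟨N, E', h1, h2, _, h3⟩ := h fun _ _ => clo (dummy _) dummyEnv
  refine ⟨N, E', fun q => .trans (steps_saturate q E _ M) ?_, h2,
    fun _ h => absurd h (Nat.not_lt_zero _), h3⟩
  rw [show dummyArgs (slotTy S d) = _ from dummyArgs_treeTy (maxRank S) d .base]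
  exact h1 q

/-! ### Every configuration is represented -/

/-- An environment with prescribed values. -/
theorem exists_env {Γ : Type} {rank : Γ → ℕ} {ι : Type*} {v : ι → LVar} (hv : v.Injective)
    (C : ∀ i, Closure rank (v i).ty) : ∃ E : Env rank, ∀ i, E (v i) = C i := by
  have key : ∀ z : LVar, ∃ e : Closure rank z.ty, ∀ i (h : v i = z), h ▸ C i = e := by
    intro z
    by_cases hz : ∃ i, v i = z
    · obtain ⟨i, rfl⟩ := hz
      refine ⟨C i, fun j h => ?_⟩
      obtain rfl := hv h
      rfl
    · exact ⟨dummyEnv z, fun i h => absurd ⟨i, h⟩ hz⟩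
  choose E hE using key
  exact ⟨E, fun i => (hE (v i) i rfl).symm⟩

/-- Closures for arbitrary trees, assembled from the node terms in the continuations `gen i`. -/
theorem exists_over_builds : ∀ t : RTree S.rank Empty,
    (∃ C : Clo S (slotTy S (groundDepth t)), C.Over (startTerm S) ∧ Builds (groundDepth t) C t) ∧
    ∃ C : Clo S (slotTy S 0), C.Over (startTerm S) ∧ Builds 0 C t
  | .var x => x.elim
  | .node a ts => by
    choose C hC using fun j => (exists_over_builds (ts j)).1
    obtain ⟨E, hE⟩ := exists_env (ι := Option (Fin (S.rank a)))
      (v := fun o => o.elim (ctorVar S) fun j => xVar S (groundDepth (ts j)) j) (by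
        rintro (_ | i) (_ | j) h
        · rfl
        · exact absurd h (ctorVar_ne (k := 0))
        · exact absurd h.symm (ctorVar_ne (k := 0))
        · injection h with _ h
          exact congrArg some (Fin.ext (pair_name_inj h).2))
      (fun o => match o with
        | none => ctorClo
        | some j => C j)
    have hG : E (ctorVar S) = ctorClo := hE none
    have hX : ∀ j : Fin (S.rank a), E (xVar S (groundDepth (ts j)) j) = C j := fun j => hE (some j)
    have hover : ∀ x ∈ (nodeTerm (nodeType (.node a ts)) (depth n (S.ord a))
        (genArgs (nodeType (.node a ts)))).fv, (E x).Over (startTerm S) := by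
      intro x hx
      rcases fv_nodeTerm hx with rfl | ⟨d, _, j, _, hx⟩
      · rw [hG]
        exact over_clo.2 ⟨isSubterm_ctorTerm, fun x hx => by rw [fv_ctorTerm] at hx; exact hx.elim⟩
      · unfold genArgs at hx
        split_ifs at hx with h
        · obtain ⟨hj, rfl⟩ := h
          obtain rfl := Set.mem_singleton_iff.1 hx
          rw [show E (xVar S ((nodeType (.node a ts)).2 ⟨j, hj⟩ : Fin n) j) = _ from hX ⟨j, hj⟩]
          exact (hC ⟨j, hj⟩).1
        · rw [fv_dummy] at hx
          exact hx.elim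
    have hbuilds : Builds (depth n (S.ord a)) (clo (nodeTerm (nodeType (.node a ts))
        (depth n (S.ord a)) (genArgs (nodeType (.node a ts)))) E) (.node a ts) := by
      refine builds_nodeTerm hG (depth n _).2.le
        (fun d hd j _ => scoped_genArgs _ _ _ hd) fun j => ?_
      have : genArgs (nodeType (.node a ts)) (groundDepth (ts j)) j =
          .var (xVar S (groundDepth (ts j)) j) := if_pos ⟨j.2, rfl⟩
      rw [this]
      refine Forwards.builds (fun q Cs => steps_var ..) ?_
      rw [hX]
      exact (hC j).2
    refine ⟨⟨_, over_clo.2 ⟨isSubterm_gen_nodeTerm (nodeType (.node a ts)), hover⟩, hbuilds⟩,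
      ⟨clo (branchTerm (.gen (nodeType (.node a ts)))) E,
        over_clo.2 ⟨isSubterm_branchTerm _, fun x hx => hover x ?_⟩, builds_saturate hbuilds⟩⟩
    rwa [branchTerm, fv_saturate] at hx

theorem Builds.exists_represents {p : S.Loc} {C : Clo S .base} {t : RTree S.rank Empty}
    (h : Builds (S := S) 0 C t) : ∃ k : Conf S, Steps ⟨code (.main p, none), C, .nil⟩ k ∧
      Represents k (p, t) := by
  obtain ⟨N, E, h1, h2, _, h3⟩ := h fun _ _ => clo (dummy _) dummyEnv
  exact ⟨_, h1 _, N, E, rfl, h2, h3⟩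

theorem exists_represents (c : S.Config) :
    ∃ k : Conf S, OverConfig (startTerm S) k ∧ Represents k c := by
  obtain ⟨_, C, hC, h⟩ := exists_over_builds c.2
  obtain ⟨k, hk, hr⟩ := h.exists_represents (p := c.1)
  exact ⟨k, over_steps hk ⟨hC, trivial⟩, hr⟩

end Representation

/-! ### Location of the variables of a rule -/

section Applicability

variable {n : ℕ} {S : AOTPS.{u, v} n}

/-- The shallow and the deep form of left-hand sides guarantee that the variables of the right-hand side
can be accessed. -/
theorem exists_applicable (ρ : S.rules) : ∃ κ, Applicable ρ κ := by
  obtain ⟨_, hv, ⟨a, ts, hl, h⟩ | ⟨a, ts, k, b, vs, hl, hk, hvs, h⟩⟩ := S.wellFormed ρ.1 ρ.2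
  · refine ⟨none, fun x hx => ?_⟩
    have hx' := hv hx
    rw [hl] at hx'
    obtain ⟨i, hi⟩ := Set.mem_iUnion.1 hx'
    rcases h i with h | ⟨y, hy⟩
    · exact absurd hx (Set.disjoint_left.1 h hi)
    · rw [hy] at hi
      obtain rfl := Set.mem_singleton_iff.1 hi
      exact ⟨i, a, ts, i.2, hl, hy⟩
  · refine ⟨some (k.castLE (rank_le_maxRank S a)), b, vs, ⟨a, ts, k.2, hl, hk⟩, fun x hx => ?_⟩
    have hx' := hv hx
    rw [hl] at hx'
    obtain ⟨i, hi⟩ := Set.mem_iUnion.1 hx'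
    by_cases hik : i = k
    · left
      rw [hik, hk] at hi
      obtain ⟨j, hj⟩ := Set.mem_iUnion.1 hi
      rcases hvs j with h | ⟨y, hy⟩
      · exact absurd hx (Set.disjoint_left.1 h hj)
      · rw [hy] at hj
        obtain rfl := Set.mem_singleton_iff.1 hj
        exact ⟨j, .node b vs, ⟨a, ts, k.2, hl, hk⟩, b, vs, j.2, rfl, hy⟩
    · right
      obtain ⟨h1, h2⟩ := h i hik
      have hng : ¬ RTree.GroundFor ρ.1.rhs (ts i) := fun h => Set.disjoint_left.1 h hi hx
      obtain ⟨y, hy⟩ := h1.resolve_left hng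
      have hi' := hi
      rw [hy] at hi'
      obtain rfl := Set.mem_singleton_iff.1 hi'
      refine ⟨⟨i, a, ts, i.2, hl, hy⟩, ?_⟩
      have := fun h => hng (h2 h)
      rw [hy] at this
      exact not_le.1 this

end Applicability

section Simulation

variable {n : ℕ} [NeZero n] {S : AOTPS.{u, v} n}

/-! ### Right-hand sides of rules -/

/-- If each variable of the right-hand side is available, then the right-hand side is built. The tree
`t'` is specified for every substitution that matches `t`, but it exists also if there is none.
This matters for termination, where matching has not been verified. -/
theorem builds_rhs {ρ : S.rules} {κ : Option (Fin (maxRank S))} {E : Env (letterRank S)}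
    (hE : E (ctorVar S) = ctorClo) {t : RTree S.rank Empty}
    (h : ∀ x ∈ ρ.1.rhs.vars, ∃ s, groundDepth s = depth n x.ord ∧
      Builds (depth n x.ord) (clo (ruleVar ρ κ x (depth n x.ord)) E) s ∧
      ∀ σ, t = ρ.1.lhs.subst σ → s = σ x) :
    ∃ t', Builds (S := S) 0 (clo (branchTerm (.rhs ρ κ)) E) t' ∧
      ∀ σ, t = ρ.1.lhs.subst σ → t' = ρ.1.rhs.subst σ := by
  have key : ∀ x, ∃ s, x ∈ ρ.1.rhs.vars → groundDepth s = depth n x.ord ∧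
      Builds (depth n x.ord) (clo (ruleVar ρ κ x (depth n x.ord)) E) s ∧
      ∀ σ, t = ρ.1.lhs.subst σ → s = σ x := by
    intro x
    by_cases hx : x ∈ ρ.1.rhs.vars
    · obtain ⟨s, hs⟩ := h x hx
      exact ⟨s, fun _ => hs⟩
    · exact ⟨t, fun h => absurd h hx⟩
  choose τ hτ using key
  refine ⟨ρ.1.rhs.subst τ, ?_, fun σ hσ => ?_⟩
  · exact builds_saturate (builds_treeTerm hE (scoped_ruleVar ρ κ) _
      fun x hx => ⟨(hτ x hx).1, (hτ x hx).2.1⟩)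
  · exact subst_congr _ fun x hx => (hτ x hx).2.2 σ hσ

theorem node_inj {Sym : Type u} {rank : Sym → ℕ} {V : Type} {a : Sym}
    {us us' : Fin (rank a) → RTree rank V} (h : RTree.node a us = .node a us') : us = us' := by
  injection h

theorem ChildAt.of_node {Sym : Type u} {rank : Sym → ℕ} {V : Type} {a : Sym}
    {us : Fin (rank a) → RTree rank V} {j : ℕ} {u : RTree rank V}
    (h : ChildAt (.node a us) j u) : ∃ h : j < rank a, us ⟨j, h⟩ = u := by
  obtain ⟨a', us', hj, h1, h2⟩ := h
  simp only [RTree.node.injEq] at h1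
  obtain ⟨rfl, h1⟩ := h1
  rw [eq_of_heq h1]
  exact ⟨hj, h2⟩

/-- The child `v` of a pattern is available in an environment that holds a tree of the same type. -/
theorem Holds.slot {a : S.Sym} {ts : Fin (S.rank a) → RTree S.rank Empty}
    {E : Env (letterRank S)} (h : Holds (.node a ts) E) {u : RTree S.rank TreeVar}
    (hu : HasType u (nodeType (.node a ts))) {j : ℕ} {v : RTree S.rank TreeVar}
    (hv : ChildAt u j v) : ∃ hj : j < S.rank a,
      groundDepth (ts ⟨j, hj⟩) = depth n (v.order S.ord) ∧
      Builds (depth n (v.order S.ord)) (E (xVar S (depth n (v.order S.ord)) j)) (ts ⟨j, hj⟩) ∧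
      ∀ σ, .node a ts = u.subst σ → ts ⟨j, hj⟩ = v.subst σ := by
  obtain ⟨us, rfl, hd⟩ := hu
  obtain ⟨hj, rfl⟩ := hv.of_node
  refine ⟨hj, hd ⟨j, hj⟩, ?_, fun σ hσ => ?_⟩
  · rw [← hd ⟨j, hj⟩]
    exact h.2 ⟨j, hj⟩
  · simp only [RTree.subst, RTree.node.injEq] at hσ
    exact congrFun (eq_of_heq hσ.2) ⟨j, hj⟩

theorem builds_rhs_shallow {ρ : S.rules} {a : S.Sym} {ts : Fin (S.rank a) → RTree S.rank Empty}
    {E : Env (letterRank S)} (h : Holds (.node a ts) E)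
    (hu : HasType ρ.1.lhs (nodeType (.node a ts))) (ha : Applicable ρ none) :
    ∃ t', Builds (S := S) 0 (clo (branchTerm (.rhs ρ none)) E) t' ∧
      ∀ σ, .node a ts = ρ.1.lhs.subst σ → t' = ρ.1.rhs.subst σ := by
  refine builds_rhs h.1 fun x hx => ?_
  have hpos := ha x hx
  obtain ⟨hj, h1, h2, h3⟩ := h.slot hu (j := hpos.choose) (v := .var x) hpos.choose_spec
  refine ⟨_, h1, ?_, h3⟩
  rw [ruleVar, dif_pos hpos]
  exact Forwards.builds (fun q Cs => steps_var ..) h2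

/-- In the deep case the right-hand side is built at the child, in `E'`. The trees in the environment
`E` of the parent are inherited if their depth is smaller than that of the child. -/
theorem builds_rhs_deep {ρ : S.rules} {k : Fin (maxRank S)} {a b : S.Sym}
    {ts : Fin (S.rank a) → RTree S.rank Empty} {vs : Fin (S.rank b) → RTree S.rank Empty}
    {E E' : Env (letterRank S)} (h : Holds (.node a ts) E) (h' : Holds (.node b vs) E')
    (hu : HasType ρ.1.lhs (nodeType (.node a ts))) {u : RTree S.rank TreeVar}
    (hk : ChildAt ρ.1.lhs k u) (hu' : HasType u (nodeType (.node b vs)))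
    (hkr : (k : ℕ) < S.rank a) (hts : ts ⟨k, hkr⟩ = .node b vs)
    (hE : ∀ d' < (depth n (S.ord b) : ℕ), ∀ j < maxRank S,
      Forwards (E' (yVar S d' j)) (E (xVar S d' j)))
    (ho : OrdersBounded ρ) (ha : Applicable ρ (some k)) :
    ∃ t', Builds (S := S) 0 (clo (branchTerm (.rhs ρ (some k))) E') t' ∧
      ∀ σ, .node a ts = ρ.1.lhs.subst σ → t' = ρ.1.rhs.subst σ := by
  have huniq : ∀ u', ChildAt ρ.1.lhs k u' → u' = u := by
    intro u' h'
    obtain ⟨us, hl, _⟩ := hu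
    rw [hl] at hk h'
    obtain ⟨_, rfl⟩ := hk.of_node
    obtain ⟨_, rfl⟩ := h'.of_node
    rfl
  obtain ⟨b', vs', hc, hx⟩ := ha
  obtain rfl := huniq _ hc
  obtain ⟨vs'', heq, _⟩ := id hu'
  simp only [RTree.node.injEq] at heq
  obtain ⟨rfl, _⟩ := heq
  refine builds_rhs h'.1 fun x hxr => ?_
  by_cases hpos : ∃ j, XPos ρ (some k) x j
  · obtain ⟨u', hk', hj'⟩ := hpos.choose_spec
    obtain rfl := huniq _ hk'
    obtain ⟨hj, h1, h2, h3⟩ := h'.slot hu' (v := .var x) hj'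
    refine ⟨_, h1, ?_, fun σ hσ => h3 σ ?_⟩
    · rw [ruleVar, dif_pos hpos]
      exact Forwards.builds (fun q Cs => steps_var ..) h2
    · obtain ⟨_, _, _, h4⟩ := h.slot hu hk
      exact hts.symm.trans (h4 σ hσ)
  · obtain ⟨hc, hord⟩ := (hx x hxr).resolve_left hpos
    obtain ⟨hj, h1, h2, h3⟩ := h.slot hu (v := .var x) hc.choose_spec
    refine ⟨_, h1, ?_, h3⟩
    have hx : x ∈ ρ.1.lhs.vars := (S.wellFormed ρ.1 ρ.2).2.1 hxr
    -- The ordering condition: an inherited variable has order larger than `b`, hence smaller depth, so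
    -- it is among the trees that the parent passes on.
    have hlt := depth_lt_depth (n := n) (S.one_le_ord _) hord (ho x hx).2
    rw [ruleVar, dif_neg hpos, dif_pos hc]
    exact Forwards.builds (fun q Cs => (steps_var ..).trans
      (hE _ hlt _ hc.choose_spec.lt_maxRank q Cs)) h2

/-! ### Reduction steps at constants -/

variable (S) in
/-- The transitions of the machine. -/
abbrev transitions : Set (Code S × (Σ a : Alphabet S, Fin (letterRank S a) → Set (Code S))) :=
  {δ | Delta S δ}

theorem delta_tag_iff {τ : Task S} {o : Option (NodeType S)} {i : Fin (Nat.card (NodeType S))}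
    {P : Fin 1 → Set (Code S)} : Delta S (code (τ, o), ⟨.tag i, P⟩) ↔
      o = none ∧ P = fun _ => {code (τ, some ((Finite.equivFin _).symm i))} := by
  constructor
  · generalize hx : ((code (τ, o), ⟨.tag i, P⟩) :
      Code S × (Σ a : Alphabet S, Fin (letterRank S a) → Set (Code S))) = x
    intro h
    cases h with
    | tag τ' i' =>
      obtain ⟨h1, h2⟩ := Prod.mk.inj hx
      obtain ⟨rfl, rfl⟩ := Prod.mk.inj (code.injective h1)
      obtain ⟨h3, h4⟩ := Sigma.mk.inj h2
      obtain rfl := Letter.tag.inj h3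
      refine ⟨rfl, ?_⟩
      rw [Equiv.symm_apply_apply]
      exact eq_of_heq h4
    | sel _ => exact nomatch (Sigma.mk.inj (Prod.mk.inj hx).2).1
  · rintro ⟨rfl, rfl⟩
    have := Delta.tag (S := S) τ ((Finite.equivFin _).symm i)
    rwa [Equiv.apply_symm_apply] at this

theorem delta_sel_iff {s : State S} {P : Fin (Nat.card (Branch S)) → Set (Code S)} :
    Delta S (code s, ⟨.sel, P⟩) ↔ ∃ τ i P', s = (τ, some i) ∧ Trans τ i P' ∧
      P = fun b => code '' P' ((Finite.equivFin (Branch S)).symm b) := by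
  constructor
  · generalize hx : ((code s, ⟨.sel, P⟩) :
      Code S × (Σ a : Alphabet S, Fin (letterRank S a) → Set (Code S))) = x
    intro h
    cases h with
    | tag τ' i' => exact nomatch (Sigma.mk.inj (Prod.mk.inj hx).2).1
    | @sel τ i P' h =>
      obtain ⟨h1, h2⟩ := Prod.mk.inj hx
      exact ⟨τ, i, P', code.injective h1, h, eq_of_heq (Sigma.mk.inj h2).2⟩
  · rintro ⟨τ, i, P', rfl, h, rfl⟩
    exact .sel h

theorem kStep_tag {τ : Task S} {i : NodeType S} {N : Clo S .base} {D : Set (Conf S)} :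
    KStep (transitions S) (tagConf (code (τ, none)) i N) D ↔
      D = {⟨code (τ, some i), N, .nil⟩} := by
  have hD : {d : Conf S | ∃ j : Fin 1, ∃ q ∈ ({code (τ, some i)} : Set (Code S)),
      d = ⟨q, ArgList.get 1 (.cons N .nil) j, .nil⟩} = {⟨code (τ, some i), N, .nil⟩} := by
    ext d
    constructor
    · rintro ⟨j, q, rfl, rfl⟩
      obtain rfl := Subsingleton.elim j 0
      rfl
    · rintro rfl
      exact ⟨0, _, rfl, rfl⟩
  refine (kStep_const (a := Letter.tag (Finite.equivFin _ i)) (Cs := .cons N .nil)).trans ?_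
  constructor
  · rintro ⟨P, hP, rfl⟩
    obtain ⟨_, rfl⟩ := delta_tag_iff.1 hP
    rw [← hD, Equiv.symm_apply_apply]
    rfl
  · rintro rfl
    exact ⟨_, Delta.tag τ i, hD.symm⟩

theorem kStep_sel {s : State S} {E : Env (letterRank S)} {D : Set (Conf S)} :
    KStep (transitions S) (selConf (code s) E) D ↔ ∃ τ i P, s = (τ, some i) ∧ Trans τ i P ∧
      D = {d | ∃ b, ∃ s ∈ P b, d = ⟨code s, clo (branchTerm b) E, .nil⟩} := by
  have hD : ∀ P : Branch S → Set (State S), {d : Conf S | ∃ j : Fin (Nat.card (Branch S)),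
      ∃ q ∈ code '' P ((Finite.equivFin (Branch S)).symm j), d = ⟨q, ArgList.get _ (pushConst _
        fun b => clo (branchTerm ((Finite.equivFin (Branch S)).symm b)) E) j, .nil⟩} =
      {d | ∃ b, ∃ s ∈ P b, d = ⟨code s, clo (branchTerm b) E, .nil⟩} := by
    intro P
    ext d
    constructor
    · rintro ⟨j, _, ⟨s, hs, rfl⟩, rfl⟩
      exact ⟨_, s, hs, by rw [get_pushConst]⟩
    · rintro ⟨b, s, hs, rfl⟩
      refine ⟨Finite.equivFin _ b, code s, ⟨s, ?_, rfl⟩, ?_⟩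
      · rwa [Equiv.symm_apply_apply]
      · rw [get_pushConst, Equiv.symm_apply_apply]
  refine (kStep_const (a := Letter.sel) (Cs := pushConst _ _)).trans ?_
  constructor
  · rintro ⟨P, hP, rfl⟩
    obtain ⟨τ, i, P', rfl, h, rfl⟩ := delta_sel_iff.1 hP
    exact ⟨τ, i, P', rfl, h, hD P'⟩
  · rintro ⟨τ, i, P, rfl, h, rfl⟩
    exact ⟨_, Delta.sel h, (hD P).symm⟩

/-- `k` represents some configuration. -/
def Halted (k : Conf S) : Prop := ∃ c, Represents k c

theorem Halted.silent_eq_none {k : Conf S} (h : Halted k) : silent k = none := by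
  obtain ⟨_, _, _, rfl, _⟩ := h
  rfl

theorem Halted.exists_state {k : Conf S} (h : Halted k) :
    ∃ p, k.state = code (.main p, none) := by
  obtain ⟨c, _, _, rfl, _⟩ := h
  exact ⟨c.1, rfl⟩

theorem not_halted_of_silent {k k' : Conf S} (h : silent k = some k') : ¬ Halted k := by
  intro hk
  rw [hk.silent_eq_none] at h
  cases h

theorem not_halted_of_state {k : Conf S} {s : State S} (hk : k.state = code s)
    (hs : ∀ p, s ≠ (.main p, none)) : ¬ Halted k := by
  intro h
  obtain ⟨p, hp⟩ := h.exists_state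
  exact hs p (code.injective (hk.symm.trans hp))

/-! ### Configurations reached by computation trees -/

/-- Some computation tree from `k`, cut at the first representing configurations, has leaves that
represent exactly the configurations in `X`. -/
def Yields (k : Conf S) (X : Set S.Config) : Prop :=
  ∃ K, RunsTo (KStep (transitions S)) Halted k K ∧ X = {c | ∃ k' ∈ K, Represents k' c}

theorem Represents.yields_iff {k : Conf S} {c : S.Config} (h : Represents k c)
    {X : Set S.Config} : Yields k X ↔ X = {c} := by
  have hX : {c' | ∃ k' ∈ ({k} : Set (Conf S)), Represents k' c'} = {c} := by
    ext c'
    constructor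
    · rintro ⟨_, rfl, h'⟩
      exact h'.unique h
    · rintro rfl
      exact ⟨k, rfl, h⟩
  constructor
  · rintro ⟨K, hK, rfl⟩
    cases hK with
    | halt _ => exact hX
    | step _ hn _ _ => exact absurd ⟨c, h⟩ hn
  · rintro rfl
    exact ⟨{k}, .halt ⟨c, h⟩, hX.symm⟩

theorem runsTo_of_unique_step {C : Type*} {R : C → Set C → Prop} {halted : C → Prop} {c d : C}
    (hn : ¬ halted c) (h : ∀ D, R c D ↔ D = {d}) {K : Set C} :
    RunsTo R halted c K ↔ RunsTo R halted d K := by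
  constructor
  · intro hK
    cases hK with
    | halt hc => exact absurd hc hn
    | step L _ hD hL =>
      obtain rfl := (h _).1 hD
      rw [Set.biUnion_singleton]
      exact hL d rfl
  · intro hK
    have := RunsTo.step (R := R) (halted := halted) (fun _ => K) hn ((h _).2 rfl)
      (fun d' hd' => by rw [Set.mem_singleton_iff.1 hd']; exact hK)
    rwa [Set.biUnion_singleton] at this

theorem yields_of_steps {k k' : Conf S} (h : Steps k k') {X : Set S.Config} :
    Yields k X ↔ Yields k' X := by
  induction h with
  | refl => rfl
  | tail _ h ih =>
    rw [ih]
    exact exists_congr fun K => and_congr_left'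
      (runsTo_of_unique_step (not_halted_of_silent h) fun D => kStep_silent h)

/-- From a closure through the announcement of the node type to the choice of a continuation. For the
tasks `main p` the announcement is a representing configuration, at which the tree is cut. -/
theorem yields_enter {τ : Task S} (hτ : ∀ p, τ ≠ .main p) {i : NodeType S} {α : STy}
    {C : Clo S α} {Cs : ArgList (letterRank S) α} {N : Clo S .base} {E : Env (letterRank S)}
    (h : ∀ q : Code S, Steps ⟨q, C, Cs⟩ (tagConf q i N)) (hN : Opens N E) {X : Set S.Config} :
    Yields ⟨code (τ, none), C, Cs⟩ X ↔ Yields (selConf (code (τ, some i)) E) X := by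
  rw [yields_of_steps (h _), ← yields_of_steps (hN _)]
  refine exists_congr fun K => and_congr_left' (runsTo_of_unique_step ?_ fun D => kStep_tag)
  exact not_halted_of_state rfl fun p hp => hτ p (congrArg Prod.fst hp)

theorem Yields.exists_trans {τ : Task S} {i : NodeType S} {E : Env (letterRank S)}
    {X : Set S.Config} (h : Yields (selConf (code (τ, some i)) E) X) :
    ∃ P, Trans τ i P ∧ ∃ F : Branch S → State S → Set S.Config,
      (∀ b, ∀ s ∈ P b, Yields ⟨code s, clo (branchTerm b) E, .nil⟩ (F b s)) ∧
      X = ⋃ b, ⋃ s ∈ P b, F b s := by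
  obtain ⟨K, hK, rfl⟩ := h
  cases hK with
  | halt hc =>
    exact absurd hc (not_halted_of_state (s := (τ, some i)) rfl fun p hp => by simp at hp)
  | step L _ hD hL =>
    obtain ⟨τ', i', P, hs, hP, rfl⟩ := kStep_sel.1 hD
    simp only [Prod.mk.injEq, Option.some.injEq] at hs
    obtain ⟨rfl, rfl⟩ := hs
    refine ⟨P, hP, fun b s => {c | ∃ k' ∈ L ⟨code s, clo (branchTerm b) E, .nil⟩,
      Represents k' c}, fun b s hs => ⟨_, hL _ ⟨b, s, hs, rfl⟩, rfl⟩, ?_⟩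
    refine Set.ext fun c =>
      Iff.trans ?_ (Set.mem_iUnion.trans (exists_congr fun b => Set.mem_iUnion₂)).symm
    constructor
    · rintro ⟨k', hk', hc⟩
      obtain ⟨_, ⟨b, s, hs, rfl⟩, hk'⟩ := Set.mem_iUnion₂.1 hk'
      exact ⟨b, s, hs, k', hk', hc⟩
    · rintro ⟨b, s, hs, k', hk', hc⟩
      exact ⟨k', Set.mem_iUnion₂.2 ⟨_, ⟨b, s, hs, rfl⟩, hk'⟩, hc⟩

/-- The sets that are reached may only depend on the state, since several continuations may lead to the
same configuration, and a computation tree continues in one way from each configuration. -/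
theorem yields_of_trans {τ : Task S} {i : NodeType S} {E : Env (letterRank S)}
    {P : Branch S → Set (State S)} (hP : Trans τ i P) (F : State S → Set S.Config)
    (hF : ∀ b, ∀ s ∈ P b, Yields ⟨code s, clo (branchTerm b) E, .nil⟩ (F s)) :
    Yields (selConf (code (τ, some i)) E) (⋃ b, ⋃ s ∈ P b, F s) := by
  have key : ∀ d : Conf S, ∃ K, (∃ b, ∃ s ∈ P b, d = ⟨code s, clo (branchTerm b) E, .nil⟩) →
      RunsTo (KStep (transitions S)) Halted d K ∧
        F (code.symm d.state) = {c | ∃ k' ∈ K, Represents k' c} := by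
    intro d
    by_cases hd : ∃ b, ∃ s ∈ P b, d = ⟨code s, clo (branchTerm b) E, .nil⟩
    · obtain ⟨b, s, hs, rfl⟩ := hd
      obtain ⟨K, hK, hX⟩ := hF b s hs
      refine ⟨K, fun _ => ⟨hK, ?_⟩⟩
      rw [Equiv.symm_apply_apply, hX]
    · exact ⟨∅, fun h => absurd h hd⟩
  choose L hL using key
  refine ⟨_, .step L (not_halted_of_state (s := (τ, some i)) rfl fun p hp => by simp at hp)
    (kStep_sel.2 ⟨τ, i, P, rfl, hP, rfl⟩) fun d hd => (hL d hd).1, ?_⟩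
  refine Set.ext fun c =>
    Iff.trans (Set.mem_iUnion.trans (exists_congr fun b => Set.mem_iUnion₂)) ?_
  constructor
  · rintro ⟨b, s, hs, hc⟩
    have h2 := (hL _ ⟨b, s, hs, rfl⟩).2
    rw [Equiv.symm_apply_apply] at h2
    rw [h2] at hc
    obtain ⟨k', hk', hc⟩ := hc
    exact ⟨k', Set.mem_iUnion₂.2 ⟨_, ⟨b, s, hs, rfl⟩, hk'⟩, hc⟩
  · rintro ⟨k', hk', hc⟩
    obtain ⟨_, ⟨b, s, hs, rfl⟩, hk'⟩ := Set.mem_iUnion₂.1 hk'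
    have h2 := (hL _ ⟨b, s, hs, rfl⟩).2
    rw [Equiv.symm_apply_apply] at h2
    refine ⟨b, s, hs, ?_⟩
    rw [h2]
    exact ⟨k', hk', hc⟩

/-! ### Matching patterns -/

theorem Holds.builds_child {a : S.Sym} {ts : Fin (S.rank a) → RTree S.rank Empty}
    {E : Env (letterRank S)} (h : Holds (.node a ts) E) (j : Fin (S.rank a)) :
    Builds (S := S) 0 (clo (branchTerm (.child (groundDepth (ts j))
      (j.castLE (rank_le_maxRank S a)))) E) (ts j) :=
  builds_saturate (Forwards.builds (fun _ _ => steps_var ..) (h.2 j))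

/-- Matching against `u` succeeds without leaves on trees that match, and fails on the others. -/
def DecidesMatch (u : RTree S.rank TreeVar) : Prop :=
  ∀ (w : Pattern S), w.1 = u → ∀ (C : Clo S .base) (t : RTree S.rank Empty),
    Builds (S := S) 0 C t → ∀ X,
      Yields ⟨code (.check w, none), C, .nil⟩ X ↔ Matches S.ord u t ∧ X = ∅

/-- If matching succeeds on all children, then the tree matches. -/
theorem matches_of_checks {a : S.Sym} {ts : Fin (S.rank a) → RTree S.rank Empty}
    {E : Env (letterRank S)} (h : Holds (.node a ts) E) {us : Fin (S.rank a) → RTree S.rank TreeVar}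
    (hus : ∀ j, DecidesMatch (us j)) (hp : ∃ ρ ∈ S.rules, .node a us ∈ subtrees ρ.lhs)
    {F : Branch S → State S → Set S.Config}
    (hF : ∀ b, ∀ s ∈ Checks (.node a us) (nodeType (.node a ts)) b,
      Yields ⟨code s, clo (branchTerm b) E, .nil⟩ (F b s)) :
    Matches S.ord (.node a us) (.node a ts) ∧
      ∀ b, ∀ s ∈ Checks (.node a us) (nodeType (.node a ts)) b, F b s = ∅ := by
  constructor
  · refine ⟨ts, rfl, fun j => ?_⟩
    obtain ⟨ρ, hρ, hsub⟩ := hp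
    set w : Pattern S := ⟨us j, ρ, hρ, child_mem_subtrees j _ hsub⟩
    have := hF _ (.check w, none) ⟨us, j, w, rfl, rfl, rfl, rfl⟩
    exact ((hus j w rfl _ _ (h.builds_child j) _).1 this).1
  · rintro b s ⟨us', j, w, heq, hw, rfl, rfl⟩
    have := hF _ _ ⟨us', j, w, heq, hw, rfl, rfl⟩
    obtain rfl : us = us' := node_inj heq
    exact ((hus j w hw _ _ (h.builds_child j) _).1 this).2

/-- Matching succeeds on all children of a tree that matches. -/
theorem yields_checks {a : S.Sym} {ts : Fin (S.rank a) → RTree S.rank Empty}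
    {E : Env (letterRank S)} (h : Holds (.node a ts) E) {u : RTree S.rank TreeVar}
    (hus : ∀ us : Fin (S.rank a) → RTree S.rank TreeVar, u = .node a us → ∀ j, DecidesMatch (us j))
    (hm : Matches S.ord u (.node a ts)) {b : Branch S} {s : State S}
    (hs : s ∈ Checks u (nodeType (.node a ts)) b) :
    Yields ⟨code s, clo (branchTerm b) E, .nil⟩ ∅ := by
  obtain ⟨us, j, w, rfl, hw, rfl, rfl⟩ := hs
  obtain ⟨ts', heq, hm⟩ := hm
  obtain rfl : ts = ts' := node_inj heq
  exact (hus us rfl j w hw _ _ (h.builds_child j) _).2 ⟨hm j, rfl⟩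

theorem decidesMatch : ∀ u : RTree S.rank TreeVar, DecidesMatch u
  | .var x => by
    intro w hw C t hC X
    obtain ⟨N, E, h1, h2, _, h3⟩ := hC fun _ _ => clo (dummy _) dummyEnv
    cases t with
    | var x => exact x.elim
    | node a ts =>
      refine (yields_enter (by simp) h1 h2).trans ⟨fun h => ?_, fun ⟨hm, hX⟩ => ?_⟩
      · obtain ⟨P, hP, F, hF, rfl⟩ := h.exists_trans
        cases hP with
        | check _ _ hc =>
          rcases hc with ⟨y, hy, hord⟩ | ⟨us, hus⟩
          · obtain rfl : x = y := by simpa [hw] using hy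
            refine ⟨hord, ?_⟩
            simp only [Set.iUnion_eq_empty]
            rintro b s ⟨us, _, _, hus, _⟩
            simp [hw] at hus
          · simp [hw] at hus
      · have := yields_of_trans (E := E) (Trans.check w (nodeType (.node a ts))
          (.inl ⟨x, hw, hm⟩)) (fun _ => ∅) (by
            rintro b s ⟨us, _, _, hus, _⟩
            simp [hw] at hus)
        rw [hX]
        simpa using this
  | .node c us => by
    intro w hw C t hC X
    obtain ⟨N, E, h1, h2, _, h3⟩ := hC fun _ _ => clo (dummy _) dummyEnv
    have ih := fun j => decidesMatch (us j)
    cases t with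
    | var x => exact x.elim
    | node a ts =>
      refine (yields_enter (by simp) h1 h2).trans ⟨fun h => ?_, fun ⟨hm, hX⟩ => ?_⟩
      · obtain ⟨P, hP, F, hF, rfl⟩ := h.exists_trans
        cases hP with
        | check _ _ hc =>
          rcases hc with ⟨y, hy, hord⟩ | ⟨us', hus⟩
          · simp [hw] at hy
          · rw [hw] at hus hF
            obtain ⟨rfl, _⟩ := RTree.node.inj hus
            have hp := w.2
            rw [hw] at hp
            obtain ⟨hm, he⟩ := matches_of_checks h3 ih hp hF
            refine ⟨hm, ?_⟩
            simp only [Set.iUnion_eq_empty]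
            intro b s hs
            rw [hw] at hs
            exact he b s hs
      · obtain ⟨ts', heq, _⟩ := id hm
        simp only [RTree.node.injEq] at heq
        obtain ⟨rfl, heq⟩ := heq
        have := yields_of_trans (E := E) (Trans.check w (nodeType (.node a ts))
          (.inr ⟨us, hw⟩)) (fun _ => ∅) (fun b s hs => by
            rw [hw] at hs
            refine yields_checks h3 (fun us' h => ?_) hm hs
            obtain rfl := node_inj h
            exact ih)
        rw [hX]
        simpa using this

/-! ### One rewriting step -/

theorem Builds.yields_main_iff {C : Clo S .base} {t : RTree S.rank Empty}
    (h : Builds (S := S) 0 C t) {q : S.Loc} {X : Set S.Config} :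
    Yields ⟨code (.main q, none), C, .nil⟩ X ↔ X = {(q, t)} := by
  obtain ⟨k, hk, hr⟩ := h.exists_represents (p := q)
  rw [yields_of_steps hk, hr.yields_iff]

/-- Launching the right-hand side `t'` yields the configurations `S × {t'}`. -/
theorem iUnion_launch_eq {ρ : S.rules} {κ : Option (Fin (maxRank S))} {E : Env (letterRank S)}
    {t' : RTree S.rank Empty} (h : Builds (S := S) 0 (clo (branchTerm (.rhs ρ κ)) E) t')
    {F : Branch S → State S → Set S.Config}
    (hF : ∀ b, ∀ s ∈ Launch ρ κ b, Yields ⟨code s, clo (branchTerm b) E, .nil⟩ (F b s)) :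
    ⋃ b, ⋃ s ∈ Launch ρ κ b, F b s = {c | c.1 ∈ ρ.1.tgt ∧ c.2 = t'} := by
  refine Set.ext fun c =>
    Iff.trans (Set.mem_iUnion.trans (exists_congr fun b => Set.mem_iUnion₂)) ?_
  constructor
  · rintro ⟨_, _, ⟨rfl, q, hq, rfl⟩, hc⟩
    have := hF _ _ ⟨rfl, q, hq, rfl⟩
    rw [h.yields_main_iff.1 this] at hc
    rw [Set.mem_singleton_iff.1 hc]
    exact ⟨hq, rfl⟩
  · rintro ⟨hq, rfl⟩
    refine ⟨.rhs ρ κ, (.main c.1, none), ⟨rfl, c.1, hq, rfl⟩, ?_⟩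
    have := hF _ _ ⟨rfl, c.1, hq, rfl⟩
    rw [h.yields_main_iff.1 this]
    rfl

/-- Going to a child while passing on one's own children of smaller depth. -/
theorem Holds.enter_deep {a : S.Sym} {ts : Fin (S.rank a) → RTree S.rank Empty}
    {E : Env (letterRank S)} (h : Holds (.node a ts) E) (j : Fin (S.rank a)) :
    ∃ N E', (∀ q : Code S, Steps ⟨q, clo (branchTerm (.deep (groundDepth (ts j))
        (j.castLE (rank_le_maxRank S a)))) E, .nil⟩ (tagConf q (nodeType (ts j)) N)) ∧
      Opens N E' ∧ Holds (ts j) E' ∧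
      ∀ d' < (groundDepth (ts j) : ℕ), ∀ j < maxRank S,
        Forwards (E' (yVar S d' j)) (E (xVar S d' j)) := by
  obtain ⟨N, E', h1, h2, h3, h4⟩ := h.2 j fun d' j' => clo (.var (xVar S d' j')) E
  refine ⟨N, E', fun q => ?_, h2, h4, fun d' hd' j' hj' q Cs =>
    (h3 d' hd' j' hj' q Cs).trans (steps_var ..)⟩
  refine .trans (steps_apps q E (fun d' j' => .var (xVar S d' j')) .nil _ _) ?_
  exact .trans (steps_var ..) (h1 q)

theorem hasType_subst {a : S.Sym} {us : Fin (S.rank a) → RTree S.rank TreeVar}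
    {σ : TreeVar → RTree S.rank Empty}
    (h : ∀ x ∈ (RTree.node a us).vars, groundOrder S.ord (σ x) = x.ord) :
    HasType (.node a us) (nodeType ((RTree.node a us).subst σ)) :=
  ⟨us, rfl, fun j => groundDepth_subst (us j) fun x hx => by
    rw [groundDepth, h x (Set.mem_iUnion.2 ⟨j, hx⟩)]⟩

/-- The second half of a deep rule. -/
theorem yields_inspect_iff {ρ : S.rules} {k : Fin (maxRank S)} {a : S.Sym}
    {ts : Fin (S.rank a) → RTree S.rank Empty} {E : Env (letterRank S)}
    (h : Holds (.node a ts) E) (hu : HasType ρ.1.lhs (nodeType (.node a ts)))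
    (hk : (k : ℕ) < S.rank a) {σ : TreeVar → RTree S.rank Empty}
    (hσ : ∀ x ∈ ρ.1.lhs.vars, groundOrder S.ord (σ x) = x.ord)
    (ht : .node a ts = ρ.1.lhs.subst σ) (ho : OrdersBounded ρ) (ha : Applicable ρ (some k))
    {X : Set S.Config} :
    Yields ⟨code (.inspect ρ k, none), clo (branchTerm (.deep (groundDepth (ts ⟨k, hk⟩)) k)) E,
      .nil⟩ X ↔ X = {c | c.1 ∈ ρ.1.tgt ∧ c.2 = ρ.1.rhs.subst σ} := by
  obtain ⟨N, E', h1, h2, h3, h4⟩ := h.enter_deep ⟨k, hk⟩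
  refine (yields_enter (by simp) h1 h2).trans ?_
  obtain ⟨b, vs, hc, -⟩ := id ha
  obtain ⟨us, hl, hd⟩ := id hu
  have hus : us ⟨k, hk⟩ = .node b vs := by
    rw [hl] at hc
    exact hc.of_node.2
  have hts : ts ⟨k, hk⟩ = (RTree.node b vs).subst σ := by
    rw [hl] at ht
    rw [← hus]
    exact congrFun (node_inj ht) ⟨k, hk⟩
  have hty : HasType (.node b vs) (nodeType (ts ⟨k, hk⟩)) := by
    rw [hts]
    refine hasType_subst fun x hx => hσ x ?_
    rw [hl]
    exact Set.mem_iUnion.2 ⟨⟨k, hk⟩, by rw [hus]; exact hx⟩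
  obtain ⟨t', hb, ht'⟩ := builds_rhs_deep (E' := E') (b := b) (vs := fun j => (vs j).subst σ) h
    (by rw [hts] at h3; exact h3) hu hc (by rw [hts] at hty; exact hty) hk hts
    (by rw [hts] at h4; exact h4) ho ha
  rw [← ht' σ ht]
  constructor
  · intro hX
    obtain ⟨P, hP, F, hF, rfl⟩ := hX.exists_trans
    cases hP with
    | inspect => exact iUnion_launch_eq hb hF
  · rintro rfl
    have hF : ∀ c, ∀ s ∈ Launch ρ (some k) c, Yields ⟨code s, clo (branchTerm c) E', .nil⟩
        {c | s = (.main c.1, none) ∧ c.2 = t'} := by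
      rintro _ _ ⟨rfl, q, hq, rfl⟩
      rw [hb.yields_main_iff]
      ext ⟨q', t⟩
      simp [Prod.ext_iff, eq_comm]
    have := yields_of_trans (.inspect ρ k _ _ hc hty ho ha)
      (fun s => {c | s = (.main c.1, none) ∧ c.2 = t'}) hF
    rwa [iUnion_launch_eq hb (F := fun _ s => {c | s = (.main c.1, none) ∧ c.2 = t'}) hF] at this

/-- The heart of the simulation: from the root of a tree, in control location `p`, exactly the
transitions of `S` are performed. -/
theorem yields_main_iff {p : S.Loc} {t : RTree S.rank Empty} {E : Env (letterRank S)}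
    (h : Holds t E) {X : Set S.Config} :
    Yields (selConf (code (.main p, some (nodeType t))) E) X ↔ S.Step (p, t) X := by
  rw [aotps_step_iff]
  cases t with
  | var x => exact x.elim
  | node a ts =>
  constructor
  · intro hX
    obtain ⟨P, hP, F, hF, rfl⟩ := hX.exists_trans
    cases hP with
    | main ρ κ _ hu ho ha =>
      obtain ⟨us, hl, hd⟩ := id hu
      have hm := matches_of_checks (F := F) h (us := us) (fun j => decidesMatch _)
        ⟨ρ.1, ρ.2, by rw [hl]; exact self_mem_subtrees _⟩
        fun b s hs => hF b s (.inl (by rw [hl]; exact hs))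
      obtain ⟨hm, he⟩ := hm
      have hm' : Matches S.ord ρ.1.lhs (.node a ts) := by rw [hl]; exact hm
      obtain ⟨σ, hσ, ht⟩ := hm'.exists_subst _ _ (S.wellFormed ρ.1 ρ.2).1
      refine ⟨ρ.1, ρ.2, σ, rfl, hσ, ht, ?_⟩
      -- The matching branches have no leaves, so only the action of the rule contributes.
      have hred : ⋃ b, ⋃ s ∈ Checks ρ.1.lhs (nodeType (.node a ts)) b ∪
          Action ρ (nodeType (.node a ts)) κ b, F b s =
          ⋃ b, ⋃ s ∈ Action ρ (nodeType (.node a ts)) κ b, F b s := by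
        refine Set.iUnion_congr fun b => ?_
        rw [Set.biUnion_union, Set.union_eq_right]
        refine Set.iUnion₂_subset fun s hs => ?_
        rw [he b s (by rw [hl] at hs; exact hs)]
        exact Set.empty_subset _
      refine hred.trans ?_
      cases κ with
      | none =>
        obtain ⟨t', hb, ht'⟩ := builds_rhs_shallow h hu ha
        rw [← ht' σ ht]
        exact iUnion_launch_eq hb fun b s hs => hF b s (.inr hs)
      | some k =>
        have hk : (k : ℕ) < S.rank a := by
          obtain ⟨b, vs, hc, _⟩ := ha
          rw [hl] at hc
          exact hc.of_node.1
        have hs : ((.inspect ρ k, none) : State S) ∈ Action ρ (nodeType (.node a ts)) (some k)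
          (.deep (groundDepth (ts ⟨k, hk⟩)) k) := ⟨hk, rfl, rfl⟩
        have := (yields_inspect_iff h hu hk hσ ht ho ha).1 (hF _ _ (.inr hs))
        rw [← this]
        refine Set.Subset.antisymm (Set.iUnion_subset fun b => Set.iUnion₂_subset ?_) ?_
        · rintro s ⟨hk', rfl, rfl⟩
          exact subset_rfl
        · exact fun c hc => Set.mem_iUnion.2 ⟨_, Set.mem_iUnion₂.2 ⟨_, hs, hc⟩⟩
  · rintro ⟨ρ, hρ, σ, rfl, hσ, ht, rfl⟩
    lift ρ to S.rules using hρ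
    obtain ⟨κ, ha⟩ := exists_applicable ρ
    have hm : Matches S.ord ρ.1.lhs (.node a ts) := by
      rw [ht]
      exact matches_subst _ hσ
    have ho : OrdersBounded ρ := fun x hx => by
      rw [← hσ x hx]
      exact ⟨groundOrder_pos _, groundOrder_le _⟩
    have hnode : ∃ us, ρ.1.lhs = .node a us := by
      obtain ⟨_, _, ⟨c, us, hl, _⟩ | ⟨c, us, _, _, _, hl, _⟩⟩ := S.wellFormed ρ.1 ρ.2 <;>
      · rw [hl] at ht
        obtain ⟨rfl, _⟩ := RTree.node.inj ht
        exact ⟨us, hl⟩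
    obtain ⟨us, hl⟩ := hnode
    have hu : HasType ρ.1.lhs (nodeType (.node a ts)) := by
      rw [ht]
      rw [hl] at hσ ⊢
      exact hasType_subst hσ
    have htrans := Trans.main ρ κ _ hu ho ha
    have hchecks : ∀ b, ∀ s ∈ Checks ρ.1.lhs (nodeType (.node a ts)) b,
        Yields ⟨code s, clo (branchTerm b) E, .nil⟩ ∅ :=
      fun b s hs => yields_checks h (fun _ _ _ => decidesMatch _) hm hs
    cases κ with
    | none =>
      obtain ⟨t', hb, ht'⟩ := builds_rhs_shallow h hu ha
      rw [← ht' σ ht]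
      have hF : ∀ b, ∀ s ∈ Launch ρ none b, Yields ⟨code s, clo (branchTerm b) E, .nil⟩
          {c | s = (.main c.1, none) ∧ c.2 = t'} := by
        rintro _ _ ⟨rfl, q, hq, rfl⟩
        rw [hb.yields_main_iff]
        ext ⟨q', t⟩
        simp [Prod.ext_iff, eq_comm]
      have := yields_of_trans (E := E) htrans (fun s => {c | s = (.main c.1, none) ∧ c.2 = t'}) (by
        rintro b s (hs | hs)
        · convert hchecks b s hs
          obtain ⟨us, j, w, _, _, rfl, _⟩ := hs
          simp
        · exact hF b s hs)
      rw [← iUnion_launch_eq hb (F := fun _ s => {c | s = (.main c.1, none) ∧ c.2 = t'}) hF]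
      convert this using 1
      refine Set.iUnion_congr fun b => ?_
      rw [Set.biUnion_union]
      refine (Set.union_eq_right.2 (Set.iUnion₂_subset ?_)).symm
      rintro s ⟨us, j, w, _, _, rfl, _⟩
      simp
    | some k =>
      have hk : (k : ℕ) < S.rank a := by
        obtain ⟨b, vs, hc, _⟩ := ha
        rw [hl] at hc
        exact hc.of_node.1
      -- `yields_of_trans` assigns sets to states: everything to `inspect ρ k`, nothing to `check w`.
      set R : Set S.Config := {c | c.1 ∈ ρ.1.tgt ∧ c.2 = ρ.1.rhs.subst σ} with hR
      have := yields_of_trans (E := E) htrans (fun s => {c | s = (.inspect ρ k, none) ∧ c ∈ R}) (by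
        rintro b s (hs | ⟨_, rfl, rfl⟩)
        · convert hchecks b s hs
          obtain ⟨us, j, w, _, _, rfl, _⟩ := hs
          simp
        · refine (yields_inspect_iff h hu hk hσ ht ho ha).2 ?_
          simp [hR])
      convert this using 1
      refine Set.Subset.antisymm (fun c hc => ?_)
        (Set.iUnion_subset fun b => Set.iUnion₂_subset fun s _ c hc => hc.2)
      exact Set.mem_iUnion.2 ⟨.deep (groundDepth (ts ⟨k, hk⟩)) k,
        Set.mem_iUnion₂.2 ⟨(.inspect ρ k, none), .inr ⟨hk, rfl, rfl⟩, rfl, hc⟩⟩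

/-! ### Termination -/

/-- No infinite reduction path from `k` avoids the representing configurations. -/
def Terminating (k : Conf S) : Prop :=
  Acc (fun k' k => ¬ Halted k ∧ ∃ D, KStep (transitions S) k D ∧ k' ∈ D) k

theorem terminating_of_halted {k : Conf S} (h : Halted k) : Terminating k :=
  .intro _ fun _ hk => absurd h hk.1

theorem terminating_of_steps {k k' : Conf S} (h : Steps k k') (hk : Terminating k') :
    Terminating k := by
  induction h using Relation.ReflTransGen.head_induction_on with
  | refl => exact hk
  | head h _ ih =>
    refine .intro _ fun d ⟨_, D, hD, hd⟩ => ?_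
    rw [(kStep_silent h).1 hD] at hd
    rw [Set.mem_singleton_iff.1 hd]
    exact ih

theorem terminating_enter {τ : Task S} {i : NodeType S} {α : STy}
    {C : Clo S α} {Cs : ArgList (letterRank S) α} {N : Clo S .base} {E : Env (letterRank S)}
    (h : ∀ q : Code S, Steps ⟨q, C, Cs⟩ (tagConf q i N)) (hN : Opens N E)
    (ht : Terminating (selConf (code (τ, some i)) E)) :
    Terminating ⟨code (τ, none), C, Cs⟩ := by
  refine terminating_of_steps (h _) (.intro _ fun d ⟨_, D, hD, hd⟩ => ?_)
  rw [kStep_tag.1 hD] at hd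
  rw [Set.mem_singleton_iff.1 hd]
  exact terminating_of_steps (hN _) ht

theorem terminating_selConf {τ : Task S} {i : NodeType S} {E : Env (letterRank S)}
    (h : ∀ P, Trans τ i P → ∀ b, ∀ s ∈ P b,
      Terminating ⟨code s, clo (branchTerm b) E, .nil⟩) :
    Terminating (selConf (code (τ, some i)) E) := by
  refine .intro _ fun d ⟨_, D, hD, hd⟩ => ?_
  obtain ⟨τ', i', P, hs, hP, rfl⟩ := kStep_sel.1 hD
  obtain ⟨rfl, hi⟩ := Prod.mk.inj hs
  obtain rfl := Option.some.inj hi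
  obtain ⟨b, s, hs, rfl⟩ := hd
  exact h P hP b s hs

theorem Builds.terminating_main {C : Clo S .base} {t : RTree S.rank Empty}
    (h : Builds (S := S) 0 C t) (q : S.Loc) : Terminating ⟨code (.main q, none), C, .nil⟩ := by
  obtain ⟨k, hk, hr⟩ := h.exists_represents (p := q)
  exact terminating_of_steps hk (terminating_of_halted ⟨_, hr⟩)

theorem terminating_check : ∀ (u : RTree S.rank TreeVar) (w : Pattern S), w.1 = u →
    ∀ (C : Clo S .base) (t : RTree S.rank Empty), Builds (S := S) 0 C t →
      Terminating ⟨code (.check w, none), C, .nil⟩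
  | u, w, hw, C, t, hC => by
    obtain ⟨N, E, h1, h2, _, h3⟩ := hC fun _ _ => clo (dummy _) dummyEnv
    cases t with
    | var x => exact x.elim
    | node a ts =>
      refine terminating_enter h1 h2 (terminating_selConf fun P hP b s hs => ?_)
      cases hP with
      | check _ _ _ =>
        obtain ⟨us, j, w', hu, hw', rfl, rfl⟩ := hs
        have hu : u = .node a us := hw.symm.trans hu
        subst hu
        exact terminating_check (us j) w' hw' _ _ (h3.builds_child j)

/-- Once the type of the root is known, a rule is tried only if its pattern has this type. So whatever
is launched builds some tree, even if matching fails on another branch, and a representing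
configuration is reached. -/
theorem terminating_main {p : S.Loc} {t : RTree S.rank Empty} {E : Env (letterRank S)}
    (h : Holds t E) : Terminating (selConf (code (.main p, some (nodeType t))) E) := by
  cases t with
  | var x => exact x.elim
  | node a ts =>
  refine terminating_selConf fun P hP b s hs => ?_
  cases hP with
  | main ρ κ _ hu ho ha =>
    rcases hs with ⟨us, j, w, _, _, rfl, rfl⟩ | hs
    · exact terminating_check _ w rfl _ _ (h.builds_child j)
    · cases κ with
      | none =>
        obtain ⟨t', hb, _⟩ := builds_rhs_shallow h hu ha
        obtain ⟨rfl, q, _, rfl⟩ := hs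
        exact hb.terminating_main q
      | some k =>
        obtain ⟨hk, rfl, rfl⟩ := hs
        obtain ⟨N, E', h1, h2, h3, h4⟩ := h.enter_deep ⟨k, hk⟩
        refine terminating_enter h1 h2 (terminating_selConf fun P hP b s hs => ?_)
        cases hP with
        | inspect _ _ _ u hc hu' _ _ =>
          obtain ⟨rfl, q, _, rfl⟩ := hs
          generalize hts : ts ⟨k, hk⟩ = t' at *
          cases t' with
          | var x => exact x.elim
          | node c vs =>
            obtain ⟨t', hb, _⟩ := builds_rhs_deep h h3 hu hc hu' hk hts h4 ho ha
            exact hb.terminating_main q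

/-! ### The encoding -/

theorem Represents.terminating_of_step {k k' : Conf S} {c : S.Config} (h : Represents k c)
    {D : Set (Conf S)} (hD : KStep (transitions S) k D) (hk' : k' ∈ D) : Terminating k' := by
  obtain ⟨N, E, rfl, h1, h2⟩ := h
  rw [kStep_tag.1 hD] at hk'
  rw [Set.mem_singleton_iff.1 hk']
  exact terminating_of_steps (h1 _) (terminating_main h2)

theorem Represents.step_iff {k : (machine S).Config} {c : S.Config} (h : Represents k.1 c)
    {X : Set S.Config} : S.Step c X ↔
      ∃ K, MacroStep (machine S).Step (fun k' => Halted k'.1) k K ∧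
        X = {c' | ∃ k' ∈ K, Represents k'.1 c'} := by
  obtain ⟨N, E, hk, h1, h2⟩ := h
  -- A representing configuration stands at a `tag`, so its only step leads to `k₁`. This is the step
  -- that a computation tree is required to make before it may be cut.
  set k₁ : Conf S := ⟨code (.main c.1, some (nodeType c.2)), N, .nil⟩ with hk₁
  have hstep : KStep (machine S).Δ k.1 {k₁} := by
    rw [hk]
    exact kStep_tag.2 rfl
  have hover := over_kStep hstep k.2 k₁ rfl
  have hiff : ∀ D, (machine S).Step k D ↔ D = {⟨k₁, hover⟩} := by
    intro D
    have : (machine S).Step k D ↔ Subtype.val '' D = {k₁} := by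
      unfold KrivineMachine.Step
      rw [hk]
      exact kStep_tag
    rw [this]
    constructor
    · exact fun h => Subtype.val_injective.image_injective
        (h.trans (Set.image_singleton (f := Subtype.val)
          (a := (⟨k₁, hover⟩ : (machine S).Config))).symm)
    · rintro rfl
      exact Set.image_singleton
  have hfirst : ∀ K, MacroStep (machine S).Step (fun k' => Halted k'.1) k K ↔
      RunsTo (machine S).Step (fun k' => Halted k'.1) ⟨k₁, hover⟩ K := by
    intro K
    constructor
    · rintro ⟨D, L, hD, hL, rfl⟩
      obtain rfl := (hiff D).1 hD
      rw [Set.biUnion_singleton]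
      exact hL _ rfl
    · intro hK
      refine ⟨_, fun _ => K, (hiff _).2 rfl, ?_,
        (Set.biUnion_singleton (⟨k₁, hover⟩ : (machine S).Config) fun _ => K).symm⟩
      rintro d rfl
      exact hK
  simp only [hfirst]
  refine (yields_main_iff (p := c.1) h2).symm.trans ((yields_of_steps (h1 _)).symm.trans ?_)
  constructor
  · rintro ⟨K, hK, rfl⟩
    obtain ⟨K', hK', rfl⟩ := runsTo_lift (M := machine S) hK hover
    exact ⟨K', hK', Set.ext fun c' => Set.exists_mem_image⟩
  · rintro ⟨K, hK, rfl⟩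
    exact ⟨_, runsTo_forget hK, Set.ext fun c' =>
      (Set.exists_mem_image (f := Subtype.val) (s := K) (p := fun k' => Represents k' c')).symm⟩

end Simulation

end OrderedPushdown

open OrderedPushdown in
theorem mainTheorem7 (n : ℕ) (hn : 0 < n) (S : AOTPS.{u, v} n) :
    ∃ (M : KrivineMachine n) (enc : S.Config → M.Config) (dec : M.Config → Option S.Config),
      IsEncoding S M enc dec := by
  classical
  have : NeZero n := ⟨hn.ne'⟩
  choose enc henc using exists_represents (S := S)
  let dec : (machine S).Config → Option S.Config :=
    fun k => if h : Halted k.1 then some h.choose else none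
  have hdec : ∀ k c, dec k = some c ↔ Represents k.1 c := by
    intro k c
    by_cases h : Halted k.1
    · simp only [dec, dif_pos h, Option.some.injEq]
      exact ⟨fun e => e ▸ h.choose_spec, fun hc => h.choose_spec.unique hc⟩
    · simp only [dec, dif_neg h, reduceCtorEq, false_iff]
      exact fun hc => h ⟨c, hc⟩
  have hsome : ∀ k, (dec k).isSome = true ↔ Halted k.1 := by
    intro k
    rw [Option.isSome_iff_exists]
    exact exists_congr (hdec k)
  refine ⟨machine S, fun c => ⟨enc c, (henc c).1⟩, dec, fun c => (hdec _ _).2 (henc c).2,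
    fun k c hk X => ?_, fun k h0 hk => ?_⟩
  · simp only [hsome, hdec]
    exact ((hdec k c).1 hk).step_iff
  · by_contra! hcon
    obtain ⟨c, hc⟩ := (hsome _).1 h0
    obtain ⟨D, hD, hmem⟩ := hk 0
    have hacc := hc.terminating_of_step hD (Set.mem_image_of_mem _ hmem)
    -- Accessibility of the first successor of the path excludes every later configuration.
    have key : ∀ x : Conf S, Terminating x → ∀ i, x ≠ (k (i + 1)).1 := by
      intro x hx
      induction hx with
      | intro x _ ih =>
        rintro i rfl
        obtain ⟨D, hD, hmem⟩ := hk (i + 1)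
        exact ih _ ⟨fun h => hcon i ((hsome _).2 h), _, hD, Set.mem_image_of_mem _ hmem⟩ (i + 1) rfl
    exact key _ hacc 0 rfl
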